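/- Let $n,\mu$ be nonnegative integers, $m=2\mu$, and $J=\begin{bmatrix}0&1\\-1&0\end{bmatrix}\otimes I_\mu$. Let $W=(W_1,\dots,W_m)$ be the quantum Wiener process on the symmetric Fock space $\mathfrak F$ over $L^2([0,\infty),\mathbb C^\mu)$, consisting of the position and momentum type quadratures of $\mu$ bosonic field channels, normalized by $W(0)=\mathcal I$ (a vector of identity operators), so that $[W(s),W(t)^{\rm T}]=2i\min(s,t)J$. Let $\mathfrak H_0$ be a complex Hilbert space and $X_0$ a vector of $n$ self-adjoint operators on $\mathfrak H_0$ satisfying the Weyl canonical commutation relations $e^{iu^{\rm T}X_0}e^{iv^{\rm T}X_0}=e^{-iu^{\rm T}\Theta v}e^{i(u+v)^{\rm T}X_0}$, $u,v\in\mathbb R^n$ (infinitesimally, $[X_0,X_0^{\rm T}]=2i\Theta$), where $\Theta$ is a nonsingular real antisymmetric $n\times n$ matrix. Consider the open quantum harmonic oscillator on $\mathfrak H_0\otimes\mathfrak F$ whose system variables $X=(X_1,\dots,X_n)$ satisfy $$dX=AX\,dt+B\,dW,\qquad X(0)=X_0,\qquad A=2\Theta(R+M^{\rm T}JM),\quad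 B=2\Theta M^{\rm T},$$ with $R=R^{\rm T}\in\mathbb R^{n\times n}$, $M\in\mathbb R^{m\times n}$, and suppose that $A$ is Hurwitz. Fix $T>0$ and, for $k=0,1,2,\dots$, put $$\omega_k=\tfrac{\pi}{T}\left(k+\tfrac12\right),\quad f_k(t)=\sqrt{\tfrac2T}\sin(\omega_kt),\quad g_k(t)=\sqrt{\tfrac2T}\cos(\omega_kt),\quad w_k=\omega_k\int_0^Tf_k(t)(W(t)-\mathcal I)\,dt,$$ $$\mho_k=(\omega_k^2I_n+A^2)^{-1},\qquad A_k=\sqrt{\tfrac2T}\,A\mho_k\left((-1)^ke^{TA}-\tfrac1{\omega_k}A\right).$$ All operators are considered on the common domain spanned by the vectors $u\otimes e(g)$, where $u$ belongs to the domains of all the entries of $X_0$ and $e(g)$ is an exponential vector of $\mathfrak F$; the stochastic equation is understood as the integral equation $X(t)=X_0+\int_0^tAX(s)\,ds+B(W(t)-W(0))$, $t\ge0$, on this domain, series of operators converge unconditionally in norm on each vector of this domain, and an operator on this domain is called a self-adjoint quantum variable if it is essentially self-adjoint there. Then the matrices $\mho_k$ are well defined, the series $$\xi=X_0+\sqrt{\tfrac2T}\sum_{k=0}^{\infty}A\mho_kBw_k$$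 converges, and with $$\alpha_k=A_k\xi+\omega_k\mho_kBw_k,\qquad\beta_k=-A\mho_kBw_k,$$ the entries of $\xi$, $\alpha_k$, $\beta_k$ and of $X(t)$ are self-adjoint quantum variables, and $$X(t)=\xi+\sum_{k=0}^{\infty}\bigl(f_k(t)\alpha_k+g_k(t)\beta_k\bigr),\qquad 0\le t\le T.$$ -/

import Mathlib

open scoped ComplexConjugate InnerProductSpace TensorProduct Kronecker Matrix

noncomputable section

section Fock

variable (E : Type*) [NormedAddCommGroup E] [InnerProductSpace ℂ E]

/-- The exponential kernel `(f, g) ↦ exp ⟪f, g⟫`. -/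
def expKernel : Matrix E E (ℂ →L[ℂ] ℂ) :=
  Matrix.of fun f g => Complex.exp ⟪f, g⟫_ℂ • ContinuousLinearMap.id ℂ ℂ

open scoped ComplexOrder in
/-- The powers of the inner product are positive semidefinite kernels. -/
theorem powKernel_nonneg (v : E →₀ ℂ) (n : ℕ) :
    0 ≤ (v.sum fun f a => v.sum fun g b => conj a * ⟪f, g⟫_ℂ ^ n * b).re := by
  have h : (Matrix.of fun f g : v.support => ⟪(f : E), (g : E)⟫_ℂ ^ n).PosSemidef := by
    induction n with
    | zero =>
      have h1 := Matrix.posSemidef_gram ℂ (fun _ : v.support => (1 : ℂ))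
      have h2 : (Matrix.of fun f g : v.support => ⟪(f : E), (g : E)⟫_ℂ ^ 0)
          = Matrix.gram ℂ (fun _ : v.support => (1 : ℂ)) := by
        ext f g
        simp [Matrix.gram]
      rw [h2]
      exact h1
    | succ n ih =>
      have h2 : (Matrix.of fun f g : v.support => ⟪(f : E), (g : E)⟫_ℂ ^ (n + 1))
          = (Matrix.of fun f g : v.support => ⟪(f : E), (g : E)⟫_ℂ ^ n).hadamard
            (Matrix.gram ℂ fun f : v.support => (f : E)) := by
        ext f g
        simp [Matrix.gram, pow_succ]
      rw [h2]
      exact ih.hadamard (Matrix.posSemidef_gram ℂ _)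
  have h3 := h.dotProduct_mulVec_nonneg fun f => v f
  have h4 : 0 ≤ Complex.re _ := (Complex.le_def.1 h3).1
  convert h4 using 2
  simp only [Finsupp.sum, dotProduct, Matrix.mulVec, Matrix.of_apply, Pi.star_apply,
    Finset.univ_eq_attach, Finset.mul_sum]
  rw [← Finset.sum_attach]
  refine Finset.sum_congr rfl fun f _ => ?_
  rw [← Finset.sum_attach]
  refine Finset.sum_congr rfl fun g _ => ?_
  simp [mul_assoc]

theorem expKernel_posSemidef : (expKernel E).PosSemidef := by
  have h0 := (RKHS.posSemidef_tfae (K := expKernel E)).out 0 2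
  refine h0.2 ⟨?_, fun v => ?_⟩
  · ext f g
    simp [expKernel, Matrix.conjTranspose_apply, ContinuousLinearMap.star_eq_adjoint,
      ← Complex.exp_conj]
    change (ContinuousLinearMap.adjoint (1 : ℂ →L[ℂ] ℂ)) 1 = 1
    rw [← ContinuousLinearMap.star_eq_adjoint, star_one]
    rfl
  · have key : ∀ f g : E, HasSum
        (fun n : ℕ => ((n.factorial : ℝ))⁻¹ * (conj (v f) * ⟪f, g⟫_ℂ ^ n * v g).re)
        (conj (v f) * Complex.exp ⟪f, g⟫_ℂ * v g).re := by
      intro f g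
      have h := NormedSpace.expSeries_div_hasSum_exp (𝔸 := ℂ) ⟪f, g⟫_ℂ
      rw [← Complex.exp_eq_exp_ℂ] at h
      have h2 := Complex.hasSum_re ((h.mul_left (conj (v f))).mul_right (v g))
      convert h2 using 2 with n
      rw [← Complex.re_ofReal_mul]
      congr 1
      push_cast
      ring
    have h1 : HasSum (fun n : ℕ => ((n.factorial : ℝ))⁻¹ *
        (v.sum fun f a => v.sum fun g b => conj a * ⟪f, g⟫_ℂ ^ n * b).re)
        (v.sum fun f a => v.sum fun g b => conj a * Complex.exp ⟪f, g⟫_ℂ * b).re := by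
      simp only [Finsupp.sum, Complex.re_sum, Finset.mul_sum]
      exact hasSum_sum fun f _ => hasSum_sum fun g _ => key f g
    have h2 := h1.nonneg fun n => mul_nonneg (by positivity) (powKernel_nonneg E v n)
    refine h2.trans_eq ?_
    change Complex.re _ = Complex.re _
    congr 1
    simp only [Finsupp.sum]
    refine Finset.sum_congr rfl fun f _ => Finset.sum_congr rfl fun g _ => ?_
    simp [expKernel, ← Complex.exp_conj]
    ring
instance : Fact (expKernel E).PosSemidef := ⟨expKernel_posSemidef E⟩

/-- The symmetric Fock space over the one-particle Hilbert space `E`, realized as the Hilbert space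
whose reproducing kernel is the exponential kernel. It is the closed span of the
exponential (coherent) vectors `expVec g`, which satisfy `⟪expVec f, expVec g⟫ = exp ⟪f, g⟫`. -/
def FockSpace : Type _ := RKHS.OfKernel (expKernel E)

instance : NormedAddCommGroup (FockSpace E) :=
  inferInstanceAs (NormedAddCommGroup (RKHS.OfKernel (expKernel E)))
instance : InnerProductSpace ℂ (FockSpace E) :=
  inferInstanceAs (InnerProductSpace ℂ (RKHS.OfKernel (expKernel E)))
instance : CompleteSpace (FockSpace E) :=
  inferInstanceAs (CompleteSpace (RKHS.OfKernel (expKernel E)))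
instance : RKHS ℂ (FockSpace E) E ℂ :=
  inferInstanceAs (RKHS ℂ (RKHS.OfKernel (expKernel E)) E ℂ)

variable {E}

/-- The exponential vector of `g`; in terms of symmetric tensors it is `⨁ₙ g^{⊗n} / √n!`. -/
def expVec (g : E) : FockSpace E := RKHS.kerFun (FockSpace E) g (1 : ℂ)

theorem expVec_apply (f g : E) : expVec g f = Complex.exp ⟪f, g⟫_ℂ := by
  have h : RKHS.kernel (FockSpace E) = expKernel E := RKHS.OfKernel.kernel_ofKernel
  rw [expVec, RKHS.kerFun_apply, h]
  simp [expKernel]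

theorem inner_expVec (f g : E) : ⟪expVec f, expVec g⟫_ℂ = Complex.exp ⟪f, g⟫_ℂ := by
  rw [← expVec_apply]
  conv_lhs => rw [expVec]
  simp

/-- Distinct exponential vectors are linearly independent. -/
theorem linearIndependent_expVec : LinearIndependent ℂ (expVec : E → FockSpace E) := by
  let χ : E → (Multiplicative E →* ℂ) := fun g =>
    { toFun := fun f => Complex.exp (conj ⟪g, f.toAdd⟫_ℂ)
      map_one' := by simp
      map_mul' := fun f f' => by simp [Complex.exp_add, -inner_conj_symm] }
  have hχ : Function.Injective χ := by
    intro g g' h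
    by_contra hne
    have hk : ∀ z : ℂ, Complex.exp (z * ⟪g, g - g'⟫_ℂ) = Complex.exp (z * ⟪g', g - g'⟫_ℂ) := by
      intro z
      have h1 := DFunLike.congr_fun h (Multiplicative.ofAdd (z • (g - g')))
      have h2 := congrArg conj h1
      simpa only [χ, MonoidHom.coe_mk, OneHom.coe_mk, toAdd_ofAdd, inner_smul_right,
        ← Complex.exp_conj, Complex.conj_conj] using h2
    have hd : ∀ c : ℂ, HasDerivAt (fun z : ℂ => Complex.exp (z * c)) c 0 := by
      intro c
      have h1 := ((hasDerivAt_id (0 : ℂ)).mul_const c).cexp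
      simpa using h1
    have h1 := (hd ⟪g, g - g'⟫_ℂ).unique (by simpa only [hk] using hd ⟪g', g - g'⟫_ℂ)
    have h2 : ⟪g - g', g - g'⟫_ℂ = 0 := by
      rw [inner_sub_left, h1, sub_self]
    exact hne (sub_eq_zero.1 (inner_self_eq_zero.1 h2))
  have h1 := (linearIndependent_monoidHom (Multiplicative E) ℂ).comp χ hχ
  let ev : FockSpace E →ₗ[ℂ] (Multiplicative E → ℂ) :=
    { toFun := fun Φ f => Φ f.toAdd
      map_add' := fun Φ Ψ => by ext; simp
      map_smul' := fun c Φ => by ext; simp }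
  refine LinearIndependent.of_comp ev ?_
  have h2 : ev ∘ (expVec : E → FockSpace E) = fun g f => χ g f := by
    ext g f
    simp [ev, χ, expVec_apply]
  rw [h2]
  exact h1

variable (E) in
/-- The exponential domain: the span of the exponential vectors. -/
def expDomain : Submodule ℂ (FockSpace E) := Submodule.span ℂ (Set.range expVec)

/-- The annihilation operator of `h` on the exponential domain, `a(h) e(g) = ⟪h, g⟫ e(g)`. -/
def annihilationOp (h : E) : expDomain E →ₗ[ℂ] FockSpace E :=
  Finsupp.linearCombination ℂ (fun g => ⟪h, g⟫_ℂ • expVec g) ∘ₗ linearIndependent_expVec.repr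

/-- The creation operator of `h` on the exponential domain; `a†(h) e(g)` is the derivative of
`z ↦ e(g + z h)` at `z = 0`. -/
def creationOp (h : E) : expDomain E →ₗ[ℂ] FockSpace E :=
  Finsupp.linearCombination ℂ (fun g => fderiv ℂ expVec g h) ∘ₗ linearIndependent_expVec.repr

/-- The field operator `a(h) + a†(h)`, for which `[φ(f), φ(h)] = 2 i Im ⟪f, h⟫`. -/
def fieldOp (h : E) : expDomain E →ₗ[ℂ] FockSpace E := annihilationOp h + creationOp h

theorem continuous_fieldOp (x : expDomain E) : Continuous fun h : E => fieldOp h x := by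
  have h : ∀ h : E, fieldOp h x = ∑ g ∈ (linearIndependent_expVec.repr x).support,
      linearIndependent_expVec.repr x g • (⟪h, g⟫_ℂ • expVec g + fderiv ℂ expVec g h) := by
    intro h
    simp only [smul_add, Finset.sum_add_distrib]
    rfl
  simp only [h]
  refine continuous_finsetSum _ fun g _ => ?_
  have h1 : Continuous fun h : E => ⟪h, g⟫_ℂ • expVec g + fderiv ℂ expVec g h := by fun_prop
  exact Continuous.smul (f := fun _ => linearIndependent_expVec.repr x g) continuous_const h1

end Fock

section Domain

variable {H₀ : Type*} [NormedAddCommGroup H₀] [InnerProductSpace ℂ H₀]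
variable {E : Type*} [NormedAddCommGroup E] [InnerProductSpace ℂ E]

variable (H₀ E) in
/-- The system-field space: the Hilbert space tensor product of the initial space `H₀` and the Fock
space over `E`. -/
abbrev SystemFieldSpace : Type _ := UniformSpace.Completion (H₀ ⊗[ℂ] FockSpace E)

variable (H₀ E) in
/-- The inclusion of the algebraic tensor product into the Hilbert space tensor product. -/
def toSystemField : H₀ ⊗[ℂ] FockSpace E →ₗ[ℂ] SystemFieldSpace H₀ E :=
  (UniformSpace.Completion.toComplL : H₀ ⊗[ℂ] FockSpace E →L[ℂ] SystemFieldSpace H₀ E)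

variable (E) in
/-- The inclusion of the algebraic tensor product of `P` and the exponential domain. -/
def domainIncl (P : Submodule ℂ H₀) : P ⊗[ℂ] expDomain E →ₗ[ℂ] SystemFieldSpace H₀ E :=
  toSystemField H₀ E ∘ₗ TensorProduct.mapIncl P (expDomain E)

variable (E) in
theorem domainIncl_injective (P : Submodule ℂ H₀) : Function.Injective (domainIncl E P) := by
  refine Function.Injective.comp (g := toSystemField H₀ E)
    (UniformSpace.Completion.coe_injective (H₀ ⊗[ℂ] FockSpace E)) (LinearMap.ker_eq_bot.1 ?_)
  refine LinearMap.ker_eq_bot'.2 fun x hx => ?_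
  have h := TensorProduct.inner_mapIncl_mapIncl (𝕜 := ℂ) P (expDomain E) x x
  rw [hx, inner_zero_left] at h
  exact (inner_self_eq_zero (𝕜 := ℂ) (E := P ⊗[ℂ] expDomain E)).1 h.symm

variable (E) in
/-- The domain in the system-field space spanned by the vectors `u ⊗ e(g)` with `u ∈ P`. -/
def tensorDomain (P : Submodule ℂ H₀) : Submodule ℂ (SystemFieldSpace H₀ E) :=
  LinearMap.range (domainIncl E P)

variable (E) in
/-- The domain `tensorDomain E P` is the algebraic tensor product of `P` and the exponential
domain. -/
def tensorDomainEquiv (P : Submodule ℂ H₀) : (P ⊗[ℂ] expDomain E) ≃ₗ[ℂ] tensorDomain E P :=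
  LinearEquiv.ofInjective (domainIncl E P) (domainIncl_injective E P)

/-- The operator `S ⊗ 1` on `tensorDomain E P`. -/
def systemAmpl {P : Submodule ℂ H₀} (S : P →ₗ[ℂ] H₀) :
    tensorDomain E P →ₗ[ℂ] SystemFieldSpace H₀ E :=
  toSystemField H₀ E ∘ₗ TensorProduct.map S (expDomain E).subtype ∘ₗ
    (tensorDomainEquiv E P).symm.toLinearMap

/-- The operator `1 ⊗ S` on `tensorDomain E P`. -/
def fieldAmpl (P : Submodule ℂ H₀) (S : expDomain E →ₗ[ℂ] FockSpace E) :
    tensorDomain E P →ₗ[ℂ] SystemFieldSpace H₀ E :=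
  toSystemField H₀ E ∘ₗ TensorProduct.map P.subtype S ∘ₗ
    (tensorDomainEquiv E P).symm.toLinearMap

theorem continuous_fieldAmpl (P : Submodule ℂ H₀) (ψ : tensorDomain E P) :
    Continuous fun h : E => fieldAmpl P (fieldOp h) ψ := by
  obtain ⟨x, rfl⟩ := (tensorDomainEquiv E P).surjective ψ
  simp only [fieldAmpl, LinearMap.comp_apply, LinearEquiv.coe_coe, LinearEquiv.symm_apply_apply]
  refine (UniformSpace.Completion.toComplL :
    H₀ ⊗[ℂ] FockSpace E →L[ℂ] SystemFieldSpace H₀ E).continuous.comp ?_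
  induction x using TensorProduct.induction_on with
  | zero => simpa using continuous_const
  | tmul u v =>
    simp only [TensorProduct.map_tmul]
    exact (TensorProduct.continuous_tmul (𝕜 := ℂ)).comp
      (continuous_const.prodMk (continuous_fieldOp v))
  | add x y hx hy => 
    simp only [map_add]
    exact Continuous.add hx hy

/-- A densely defined operator on a Hilbert space is essentially self-adjoint if its closure is
self-adjoint. -/
def IsEssentiallySelfAdjoint {H : Type*} [NormedAddCommGroup H] [InnerProductSpace ℂ H]
    [CompleteSpace H] (S : H →ₗ.[ℂ] H) : Prop :=
  Dense (S.domain : Set H) ∧ S.IsClosable ∧ IsSelfAdjoint S.closure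

/-- An operator with domain `D` represents a self-adjoint quantum variable (its closure) if it is
essentially self-adjoint on `D`. -/
def IsQuantumVariable {H : Type*} [NormedAddCommGroup H] [InnerProductSpace ℂ H]
    [CompleteSpace H] {D : Submodule ℂ H} (S : D →ₗ[ℂ] H) : Prop :=
  IsEssentiallySelfAdjoint (⟨D, S⟩ : H →ₗ.[ℂ] H)

/-- The product of a real matrix and a column vector whose entries are operators. -/
def opMulVec {ι κ H : Type*} [Fintype κ] [AddCommGroup H] [Module ℂ H] {D : Submodule ℂ H}
    (M : Matrix ι κ ℝ) (V : κ → (D →ₗ[ℂ] H)) : ι → (D →ₗ[ℂ] H) :=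
  fun i => ∑ k, (M i k : ℂ) • V k

end Domain

section Weyl

variable {H₀ : Type*} [NormedAddCommGroup H₀] [InnerProductSpace ℂ H₀]

/-- The Stone generator `-i (d/dt) U(t) |_{t = 0}` of a one-parameter family of operators, on its
natural domain. If `U` is a strongly continuous unitary group, then this is the self-adjoint
operator `S` with `U(t) = exp(i t S)`. -/
def stoneGenerator (U : ℝ → H₀ →L[ℂ] H₀) : H₀ →ₗ.[ℂ] H₀ where
  domain :=
    { carrier := {ψ | DifferentiableAt ℝ (fun t => U t ψ) 0}
      add_mem' := fun {ψ χ} hψ hχ => by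
        simpa only [Set.mem_ofPred_eq, map_add] using DifferentiableAt.fun_add hψ hχ
      zero_mem' := by simp
      smul_mem' := fun c ψ hψ => by
        simpa only [Set.mem_ofPred_eq, map_smul] using DifferentiableAt.fun_const_smul hψ c }
  toFun :=
    { toFun := fun ψ => -Complex.I • deriv (fun t => U t ψ) 0
      map_add' := fun ψ χ => by
        simp only [Submodule.coe_add, map_add]
        rw [deriv_fun_add ψ.2 χ.2, smul_add]
      map_smul' := fun c ψ => by
        simp only [Submodule.coe_smul, map_smul, RingHom.id_apply]
        rw [deriv_fun_const_smul c ψ.2, smul_comm] }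

/-- The operators `X₀ 0, …, X₀ (n - 1)` are self-adjoint operators on `H₀` which satisfy the Weyl
canonical commutation relations with the matrix `Θ` (in the infinitesimal form,
`[X₀, X₀ᵀ] = 2 i Θ`): here `U u` is the unitary operator `exp(i uᵀ X₀)`. -/
def SatisfiesWeylCCR [CompleteSpace H₀] {n : ℕ} (Θ : Matrix (Fin n) (Fin n) ℝ)
    (X₀ : Fin n → H₀ →ₗ.[ℂ] H₀) : Prop :=
  ∃ U : (Fin n → ℝ) → H₀ →L[ℂ] H₀,
    (∀ u, U u ∈ unitary (H₀ →L[ℂ] H₀)) ∧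
    (∀ ψ, Continuous fun u => U u ψ) ∧
    (∀ u v, U u * U v = Complex.exp (-Complex.I * ((u ⬝ᵥ Θ *ᵥ v : ℝ) : ℂ)) • U (u + v)) ∧
    ∀ j, X₀ j = stoneGenerator fun t => U (Pi.single j t)

/-- The common domain of the operators `X₀ j`. -/
def initialDomain {n : ℕ} (X₀ : Fin n → H₀ →ₗ.[ℂ] H₀) : Submodule ℂ H₀ :=
  ⨅ j, (X₀ j).domain

end Weyl

section Wiener

open MeasureTheory

/-- The one-particle space `L²([0, ∞), ℂ^μ)` of `μ` field channels. -/
abbrev OneParticle (μ : ℕ) : Type :=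
  Lp (EuclideanSpace ℂ (Fin μ)) 2 (volume.restrict (Set.Ici (0 : ℝ)))

variable {μ n : ℕ} {H₀ : Type*} [NormedAddCommGroup H₀] [InnerProductSpace ℂ H₀]

/-- The test function `1_[0,t] c_k` of the `k`-th field variable, where `c_(0,j)` is the `j`-th
basis vector of `ℂ^μ` (position type quadrature), and `c_(1,j)` is this vector times `i`
(momentum type quadrature). -/
def wienerTest (t : ℝ) (k : Fin 2 × Fin μ) : OneParticle μ :=
  indicatorConstLp 2 (measurableSet_Icc : MeasurableSet (Set.Icc 0 t))
    ((Measure.restrict_apply_le _ _).trans_lt measure_Icc_lt_top).ne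
    (EuclideanSpace.single k.2 (if k.1 = 0 then 1 else Complex.I))

theorem continuous_wienerTest (k : Fin 2 × Fin μ) : Continuous fun t => wienerTest t k := by
  refine continuous_indicatorConstLp_set (by simp) fun x => ?_
  have hle : ∀ y : ℝ, (volume.restrict (Set.Ici (0 : ℝ)))
      (symmDiff (Set.Icc 0 y) (Set.Icc 0 x)) ≤ ENNReal.ofReal |y - x| := by
    intro y
    refine (Measure.restrict_apply_le _ _).trans ?_
    refine (measure_mono (t := Set.Icc (min x y) (max x y)) ?_).trans ?_
    · intro s hs
      rcases hs with ⟨h1, h2⟩ | ⟨h1, h2⟩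
      · simp only [Set.mem_Icc, not_and, not_le] at h1 h2 ⊢
        exact ⟨(min_le_left _ _).trans (h2 h1.1).le, h1.2.trans (le_max_right _ _)⟩
      · simp only [Set.mem_Icc, not_and, not_le] at h1 h2 ⊢
        exact ⟨(min_le_right _ _).trans (h2 h1.1).le, h1.2.trans (le_max_left _ _)⟩
    · rw [Real.volume_Icc, max_sub_min_eq_abs]
  refine tendsto_of_tendsto_of_tendsto_of_le_of_le tendsto_const_nhds ?_ (fun _ => zero_le) hle
  have h : Filter.Tendsto (fun y : ℝ => ENNReal.ofReal |y - x|) (nhds x)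
      (nhds (ENNReal.ofReal |x - x|)) :=
    (ENNReal.continuous_ofReal.comp (by fun_prop)).tendsto x
  simpa using h

/-- Operators on the system-field space, defined on the span of the vectors `u ⊗ e(g)`, where `u`
belongs to the domains of all the initial system variables. -/
abbrev DomainOp (μ : ℕ) (X₀ : Fin n → H₀ →ₗ.[ℂ] H₀) : Type _ :=
  tensorDomain (OneParticle μ) (initialDomain X₀) →ₗ[ℂ] SystemFieldSpace H₀ (OneParticle μ)

/-- The initial system variables `X₀ j ⊗ 1`. -/
def initialOp (μ : ℕ) (X₀ : Fin n → H₀ →ₗ.[ℂ] H₀) (j : Fin n) : DomainOp μ X₀ :=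
  systemAmpl ((X₀ j).toFun ∘ₗ Submodule.inclusion (iInf_le _ j))

/-- The quantum Wiener process `W` of `m = 2 μ` channels, normalized so that its entries at `t = 0`
are the identity operator. The entries `(0, j)` and `(1, j)` are the quadratures of the `j`-th field
channel, and `[W(s), W(t)ᵀ] = 2 i min(s,t) J`. -/
def wiener (X₀ : Fin n → H₀ →ₗ.[ℂ] H₀) (t : ℝ) (k : Fin 2 × Fin μ) : DomainOp μ X₀ :=
  Submodule.subtype _ + fieldAmpl _ (fieldOp (wienerTest t k))

theorem continuous_wiener (X₀ : Fin n → H₀ →ₗ.[ℂ] H₀) (k : Fin 2 × Fin μ)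
    (ψ : tensorDomain (OneParticle μ) (initialDomain X₀)) :
    Continuous fun t => wiener X₀ t k ψ :=
  continuous_const.add ((continuous_fieldAmpl _ ψ).comp (continuous_wienerTest k))

/-- The frequencies `ω_k`. -/
def freq (T : ℝ) (k : ℕ) : ℝ := Real.pi / T * (k + 1 / 2)

/-- The sine functions `f_k`. -/
def sineFun (T : ℝ) (k : ℕ) (t : ℝ) : ℝ := √(2 / T) * Real.sin (freq T k * t)

theorem continuous_sineFun (T : ℝ) (k : ℕ) : Continuous (sineFun T k) := by
  unfold sineFun
  fun_prop

/-- The cosine functions `g_k`. -/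
def cosineFun (T : ℝ) (k : ℕ) (t : ℝ) : ℝ := √(2 / T) * Real.cos (freq T k * t)

/-- The coefficients of the Karhunen-Loeve expansion of the quantum Wiener process,
`w_k = ω_k ∫_0^T f_k(t) (W(t) - W(0)) dt`, with the integral applied to each vector of the domain. -/
def qklCoeff (X₀ : Fin n → H₀ →ₗ.[ℂ] H₀) (T : ℝ) (k : ℕ) (j : Fin 2 × Fin μ) :
    DomainOp μ X₀ where
  toFun ψ := (freq T k : ℂ) • ∫ t in (0 : ℝ)..T, (sineFun T k t : ℂ) • (wiener X₀ t j ψ - ψ)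
  map_add' ψ χ := by
    have h : ∀ ψ : tensorDomain (OneParticle μ) (initialDomain X₀), IntervalIntegrable
        (fun t => (sineFun T k t : ℂ) • (wiener X₀ t j ψ - ψ)) volume 0 T := fun ψ =>
      (Continuous.smul (Complex.continuous_ofReal.comp (continuous_sineFun T k))
        ((continuous_wiener X₀ j ψ).sub continuous_const)).intervalIntegrable _ _
    rw [← smul_add, ← intervalIntegral.integral_add (h ψ) (h χ)]
    congr 2
    funext t
    rw [map_add, Submodule.coe_add, add_sub_add_comm, smul_add]
  map_smul' c ψ := by
    rw [RingHom.id_apply, smul_comm c (freq T k : ℂ), ← intervalIntegral.integral_smul c]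
    congr 2
    funext t
    rw [map_smul, Submodule.coe_smul, ← smul_sub, smul_comm c]

end Wiener

section OQHO

variable {μ n : ℕ}

/-- The matrix `J = [0, 1; -1, 0] ⊗ I_μ`. -/
def fieldCCRMatrix (μ : ℕ) : Matrix (Fin 2 × Fin μ) (Fin 2 × Fin μ) ℝ :=
  !![0, 1; -1, 0] ⊗ₖ (1 : Matrix (Fin μ) (Fin μ) ℝ)

/-- The drift matrix `A = 2 Θ (R + Mᵀ J M)`. -/
def driftMatrix (Θ R : Matrix (Fin n) (Fin n) ℝ) (M : Matrix (Fin 2 × Fin μ) (Fin n) ℝ) :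
    Matrix (Fin n) (Fin n) ℝ :=
  (2 : ℝ) • (Θ * (R + Mᵀ * fieldCCRMatrix μ * M))

/-- The dispersion matrix `B = 2 Θ Mᵀ`. -/
def dispersionMatrix (Θ : Matrix (Fin n) (Fin n) ℝ) (M : Matrix (Fin 2 × Fin μ) (Fin n) ℝ) :
    Matrix (Fin n) (Fin 2 × Fin μ) ℝ :=
  (2 : ℝ) • (Θ * Mᵀ)

/-- A real matrix is Hurwitz if all its eigenvalues have negative real parts. -/
def IsHurwitz (A : Matrix (Fin n) (Fin n) ℝ) : Prop :=
  ∀ z ∈ spectrum ℂ (A.map Complex.ofReal), z.re < 0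

/-- The process `X` is a solution of the linear quantum stochastic differential equation
`dX = A X dt + B dW` with the initial value `X₀`, that is,
`X(t) = X₀ + ∫_0^t A X(s) ds + B (W(t) - W(0))` for all `t ≥ 0` as operators on the domain. -/
structure IsQSDESolution {H₀ : Type*} [NormedAddCommGroup H₀] [InnerProductSpace ℂ H₀]
    (A : Matrix (Fin n) (Fin n) ℝ) (B : Matrix (Fin n) (Fin 2 × Fin μ) ℝ)
    (X₀ : Fin n → H₀ →ₗ.[ℂ] H₀) (X : ℝ → Fin n → DomainOp μ X₀) : Prop where
  intervalIntegrable : ∀ t, 0 ≤ t → ∀ j ψ,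
    IntervalIntegrable (fun s => X s j ψ) MeasureTheory.volume 0 t
  integral_eq : ∀ t, 0 ≤ t → ∀ i ψ,
    X t i ψ = initialOp μ X₀ i ψ + (∫ s in (0 : ℝ)..t, opMulVec A (X s) i ψ)
      + opMulVec B (fun k => wiener X₀ t k - wiener X₀ 0 k) i ψ

/-- The matrix `ω_k² I + A²`, whose inverse is `℧_k`. -/
def mhoInv (A : Matrix (Fin n) (Fin n) ℝ) (T : ℝ) (k : ℕ) : Matrix (Fin n) (Fin n) ℝ :=
  freq T k ^ 2 • (1 : Matrix (Fin n) (Fin n) ℝ) + A ^ 2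

/-- The matrix `℧_k = (ω_k² I + A²)⁻¹`. -/
def mho (A : Matrix (Fin n) (Fin n) ℝ) (T : ℝ) (k : ℕ) : Matrix (Fin n) (Fin n) ℝ :=
  (mhoInv A T k)⁻¹

/-- The matrix `A_k = √(2/T) A ℧_k ((-1)^k exp(T A) - ω_k⁻¹ A)`. -/
def expCoeff (A : Matrix (Fin n) (Fin n) ℝ) (T : ℝ) (k : ℕ) : Matrix (Fin n) (Fin n) ℝ :=
  √(2 / T) • (A * mho A T k * ((-1 : ℝ) ^ k • NormedSpace.exp (T • A) - (freq T k)⁻¹ • A))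

end OQHO

end

/-! For a fixed vector `ψ` of the domain, `h ↦ φ(h)ψ` (with `φ(h)` the field operator) is a
continuous real linear map `L ψ` from the one-particle space. Since `W_j(t) - 1` is `φ(b_j(t))` with
`b_j(t) = 1_[0,t] c_j`, every statement about the noise is the image under `L ψ` of a statement
about the curve `b_j`, which satisfies `⟪b_j(s), b_j(t)⟫ = min(s,t)`. The convergence questions thus
become Hilbert space questions about such curves.

The functions `f_k` are eigenfunctions of the kernel `min(s,t)` with eigenvalues `ω_k⁻²`. Hence the
vectors `e_k = ω_k ∫ f_k b` are orthonormal (`orthonormal_klVec`), and Mercer's identity `∑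
(f_k(t)/ω_k)² = t` gives `b(t) = ∑ (f_k(t)/ω_k) e_k` (`hasSum_klVec`). Put `z(t) = ∑ (f_k(t) ω_k ℧_k
B e_k - g_k(t) A ℧_k B e_k)`. The identity `ω_k² ℧_k = 1 - A² ℧_k` shows that each term, after
subtraction of `(f_k/ω_k) B e_k`, has derivative `A` times the term. The coefficients are `O(1/k)`,
so orthonormality bounds the partial sums uniformly in `t`, and dominated convergence gives `z(t) -
z(0) = ∫_0^t A z + B b(t)` (`forcedSol_sub_eq`).

Uniqueness for the linear integral equation then yields `X(t) = e^{tA} ξ + φ(z(t))` with `ξ = X₀ -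
φ(z(0))`. At `t = 0` only the cosine terms of `z` survive, which is the series for `ξ`. The
functions `e^{tA} - 1` vanish at `0` and have sine coefficients `∫ f_k (e^{tA} - 1) = A_k`
(`integral_sineFun_mul_exp`); adding both series gives the expansion of `X(t) - ξ`.

Every operator in the conclusion has the form `a·X₀ + φ(h)` with real `a`. Weyl operators on the
system tensored with displacement operators on the Fock space are isometries that preserve the
domain and have this operator as generator. This makes it essentially self-adjoint by the invariant
domain criterion (`isQuantumVariable_of_hasDerivAt`). -/

noncomputable section

/-! ### Essential self-adjointness: vanishing deficiency spaces and invariant domains. -/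

section EssentialSelfAdjointness

variable {H : Type*} [NormedAddCommGroup H] [InnerProductSpace ℂ H] [CompleteSpace H]
  {D : Submodule ℂ H}

/-- A symmetric densely defined operator whose deficiency spaces vanish is essentially
self-adjoint. -/
theorem isQuantumVariable_of_deficiency {S : D →ₗ[ℂ] H} (hD : Dense (D : Set H))
    (hsymm : ∀ ψ χ : D, ⟪S ψ, (χ : H)⟫_ℂ = ⟪(ψ : H), S χ⟫_ℂ)
    (hpos : ∀ φ : H, (∀ ψ : D, ⟪φ, S ψ⟫_ℂ = Complex.I * ⟪φ, (ψ : H)⟫_ℂ) → φ = 0)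
    (hneg : ∀ φ : H, (∀ ψ : D, ⟪φ, S ψ⟫_ℂ = -Complex.I * ⟪φ, (ψ : H)⟫_ℂ) → φ = 0) :
    IsQuantumVariable S := by
  let L : H →ₗ.[ℂ] H := ⟨D, S⟩
  have hL : Dense (L.domain : Set H) := hD
  have hLform : L.IsFormalAdjoint L := fun ψ χ => hsymm ψ χ
  have hle : L ≤ L.adjoint := hLform.le_adjoint hL
  have hcl : L.adjoint.IsClosed := by
    exact LinearPMap.adjoint_isClosed hL
  have hclosable : L.IsClosable := hcl.isClosable.leIsClosable hle
  refine ⟨hD, hclosable, ?_⟩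
  change IsSelfAdjoint L.closure
  -- The graph is moved to the `L²` product, which has an inner product, so that an element of the
  -- adjoint's graph can be projected orthogonally onto the closure of the graph of `L`.
  let e := (WithLp.prodContinuousLinearEquiv 2 ℂ H H)
  let G : Submodule ℂ (WithLp 2 (H × H)) :=
    (L.graph.map (e.symm.toLinearEquiv : (H × H) →ₗ[ℂ] WithLp 2 (H × H))).topologicalClosure
  have hGmem : ∀ ψ : D, WithLp.toLp 2 ((ψ : H), S ψ) ∈ G := fun ψ =>
    Submodule.le_topologicalClosure _ ⟨((ψ : H), S ψ), L.mem_graph ψ, rfl⟩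
  have hGclosure : ∀ z ∈ G, e z ∈ L.graph.topologicalClosure := by
    intro z hz
    have h1 : Set.MapsTo e (L.graph.map (e.symm.toLinearEquiv : (H × H) →ₗ[ℂ] WithLp 2 (H × H)) :
        Set _)
        (L.graph : Set (H × H)) := by
      rintro _ ⟨w, hw, rfl⟩
      simpa using hw
    exact h1.closure e.continuous hz
  have : CompleteSpace G := (Submodule.isClosed_topologicalClosure _).completeSpace_coe
  have hgraph : L.adjoint.graph ≤ L.graph.topologicalClosure := by
    intro z hz
    obtain ⟨g, hg, a, ha, hga⟩ := G.exists_add_mem_mem_orthogonal (e.symm z)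
    have hadj : ∀ w : H × H, w ∈ L.adjoint.graph → ∀ ψ : D, ⟪w.2, (ψ : H)⟫_ℂ = ⟪w.1, S ψ⟫_ℂ := by
      intro w hw ψ
      obtain ⟨y, hy1, hy2⟩ := (LinearPMap.mem_graph_iff _).1 hw
      rw [← hy1, ← hy2]
      exact LinearPMap.adjoint_isFormalAdjoint hL y ψ
    have hgle : L.graph.topologicalClosure ≤ L.adjoint.graph :=
      Submodule.topologicalClosure_minimal _ (LinearPMap.le_graph_of_le hle) hcl
    have h1 := hadj (e g) (hgle (hGclosure g hg))
    have h2 := hadj z hz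
    have hz' : z = e g + e a := by
      rw [← map_add, ← hga]
      simp
    have h3 : ∀ ψ : D, ⟪(e a).2, (ψ : H)⟫_ℂ = ⟪(e a).1, S ψ⟫_ℂ := by
      intro ψ
      have := h2 ψ
      rw [hz', Prod.fst_add, Prod.snd_add, inner_add_left, inner_add_left, h1 ψ] at this
      exact add_left_cancel this
    -- Write `a = (a₁, a₂)` for the orthogonal remainder. It lies in the graph of the adjoint, so
    -- `a₂ = L* a₁`, and orthogonality to the graph of `L` says `a₁ = -L* a₂`. Hence `a₂ ± i a₁` are
    -- deficiency vectors, and both vanish.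
    have h4 : ∀ ψ : D, ⟪(e a).1, (ψ : H)⟫_ℂ + ⟪(e a).2, S ψ⟫_ℂ = 0 := by
      intro ψ
      have := (Submodule.mem_orthogonal' _ _).1 ha _ (hGmem ψ)
      rwa [WithLp.prod_inner_apply] at this
    have h5 : (e a).2 + Complex.I • (e a).1 = 0 := by
      refine hneg _ fun ψ => ?_
      rw [inner_add_left, inner_add_left, inner_smul_left, inner_smul_left, h3, ← h3,
        eq_neg_of_add_eq_zero_right (h4 ψ)]
      simp only [Complex.conj_I]
      linear_combination (- ⟪(e a).1, (ψ : H)⟫_ℂ) * Complex.I_sq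
    have h6 : (e a).2 - Complex.I • (e a).1 = 0 := by
      refine hpos _ fun ψ => ?_
      rw [inner_sub_left, inner_sub_left, inner_smul_left, inner_smul_left, h3, ← h3,
        eq_neg_of_add_eq_zero_right (h4 ψ)]
      simp only [Complex.conj_I]
      linear_combination (- ⟪(e a).1, (ψ : H)⟫_ℂ) * Complex.I_sq
    have h7 : (e a).2 = 0 := by
      have : (2 : ℂ) • (e a).2 = 0 := by
        have h := congrArg₂ (· + ·) h5 h6
        simpa [two_smul] using h
      simpa using this
    have h8 : (e a).1 = 0 := by
      rw [h7, zero_add] at h5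
      simpa using h5
    have h9 : e a = 0 := Prod.ext h8 h7
    rw [hz', h9, add_zero]
    exact hGclosure g hg
  have hclos_adj : L.closure = L.adjoint := by
    refine LinearPMap.eq_of_eq_graph (le_antisymm ?_ ?_)
    · rw [← hclosable.graph_closure_eq_closure_graph]
      exact Submodule.topologicalClosure_minimal _ (LinearPMap.le_graph_of_le hle) hcl
    · rw [← hclosable.graph_closure_eq_closure_graph]
      exact hgraph
  rw [LinearPMap.isSelfAdjoint_def]
  have hdc : Dense (L.closure.domain : Set H) := hL.mono (LinearPMap.le_closure L).1
  refine le_antisymm ?_ (LinearPMap.IsFormalAdjoint.le_adjoint hdc fun x y => ?_)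
  · conv_rhs => rw [hclos_adj]
    refine LinearPMap.IsFormalAdjoint.le_adjoint hL fun ψ y => ?_
    have hy := (LinearPMap.adjoint_isFormalAdjoint hdc).symm
      ⟨ψ, (LinearPMap.le_closure L).1 ψ.2⟩ y
    rwa [← (LinearPMap.le_closure L).2 (x := ψ) rfl] at hy
  · have hx : ((x : H), L.closure x) ∈ L.adjoint.graph := by
      rw [← hclos_adj]
      exact LinearPMap.mem_graph _ x
    obtain ⟨x', hx1, hx2⟩ := (LinearPMap.mem_graph_iff _).1 hx
    have hy : ((y : H), L.closure y) ∈ L.graph.topologicalClosure := by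
      rw [hclosable.graph_closure_eq_closure_graph]
      exact LinearPMap.mem_graph _ y
    let C : Set (H × H) := {w | ⟪L.closure x, w.1⟫_ℂ = ⟪(x : H), w.2⟫_ℂ}
    have hC : _root_.IsClosed C := isClosed_eq (by fun_prop) (by fun_prop)
    refine closure_minimal (s := (L.graph : Set (H × H))) (t := C) ?_ hC hy
    intro w hw
    obtain ⟨w', hw1, hw2⟩ := (LinearPMap.mem_graph_iff _).1 hw
    have := LinearPMap.adjoint_isFormalAdjoint hL x' w'
    rw [hx1, hx2, hw1, hw2] at this
    exact this

/-- **Invariant domain criterion**: an operator on a dense domain is essentially self-adjoint if the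
domain is invariant under isometries `V t` with `V 0 = 1` and `(d/dt) V t ψ = i S V t ψ`. -/
theorem isQuantumVariable_of_hasDerivAt {S : D →ₗ[ℂ] H} (hD : Dense (D : Set H))
    (V : ℝ → D → D) (hV0 : ∀ ψ, V 0 ψ = ψ)
    (hVinner : ∀ t ψ χ, ⟪(V t ψ : H), (V t χ : H)⟫_ℂ = ⟪(ψ : H), (χ : H)⟫_ℂ)
    (hV : ∀ t ψ, HasDerivAt (fun s => (V s ψ : H)) (Complex.I • S (V t ψ)) t) :
    IsQuantumVariable S := by
  have hdef : ∀ (w : ℂ) (r : ℝ), Complex.I * w = r → r ≠ 0 → ∀ φ : H,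
      (∀ ψ : D, ⟪φ, S ψ⟫_ℂ = w * ⟪φ, (ψ : H)⟫_ℂ) → φ = 0 := by
    intro w r hwr hr φ hφ
    refine hD.eq_zero_of_inner_left ℂ fun ψ hψ => ?_
    -- Pairing a deficiency vector with the orbit of `ψ` gives `f' = r f`, so `f` is a real
    -- exponential; isometry makes it bounded on the whole line, which forces `f 0 = 0`.
    let f : ℝ → ℂ := fun t => ⟪φ, (V t ⟨ψ, hψ⟩ : H)⟫_ℂ
    have hf : ∀ t, HasDerivAt f (r * f t) t := by
      intro t
      have h := (hasDerivAt_const t φ).inner ℂ (hV t ⟨ψ, hψ⟩)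
      rw [inner_zero_left, add_zero, inner_smul_right, hφ, ← mul_assoc, hwr] at h
      exact h
    have hg : ∀ t, HasDerivAt (fun t : ℝ => Complex.exp (-((r : ℂ) * (t : ℝ))) * f t) 0 t := by
      intro t
      have h1 : HasDerivAt (fun t : ℝ => Complex.exp (-((r : ℂ) * (t : ℝ))))
          (Complex.exp (-(r * t)) * (-r)) t := by
        have := ((hasDerivAt_id (t : ℂ)).const_mul (-(r : ℂ))).cexp.comp_ofReal
        simpa using this
      exact (h1.mul (hf t)).congr_deriv (by ring)
    have hconst : ∀ t : ℝ, Complex.exp (-(r * t)) * f t = f 0 := by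
      intro t
      have := is_const_of_deriv_eq_zero (fun t => (hg t).differentiableAt)
        (fun t => (hg t).deriv) t 0
      simpa using this
    have hbound : ∀ t, ‖f t‖ ≤ ‖φ‖ * ‖ψ‖ := by
      intro t
      refine (norm_inner_le_norm _ _).trans_eq ?_
      congr 1
      have := hVinner t ⟨ψ, hψ⟩ ⟨ψ, hψ⟩
      rw [inner_self_eq_norm_sq_to_K, inner_self_eq_norm_sq_to_K] at this
      have h2 : ‖(V t ⟨ψ, hψ⟩ : H)‖ ^ 2 = ‖ψ‖ ^ 2 := by exact_mod_cast this
      exact (sq_eq_sq₀ (norm_nonneg _) (norm_nonneg _)).1 h2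
    have hlim : Filter.Tendsto (fun s : ℝ => Real.exp (-s) * (‖φ‖ * ‖ψ‖)) Filter.atTop
        (nhds (0 * (‖φ‖ * ‖ψ‖))) :=
      Real.tendsto_exp_neg_atTop_nhds_zero.mul_const _
    rw [zero_mul] at hlim
    have h0 : ‖f 0‖ ≤ 0 := by
      refine ge_of_tendsto' hlim fun s => ?_
      -- The time `s / r` turns the factor into `exp(-s)` for either sign of `r`, so one limit `s →
      -- ∞` serves both deficiency spaces.
      have h1 := hconst (s / r)
      rw [← h1, norm_mul, Complex.norm_exp]
      have h2 : (-((r : ℂ) * ((s / r : ℝ) : ℂ))).re = -s := by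
        rw [← Complex.ofReal_mul, mul_div_cancel₀ _ hr]
        simp
      rw [h2]
      exact mul_le_mul_of_nonneg_left (hbound _) (Real.exp_pos _).le
    have h1 : f 0 = 0 := norm_le_zero_iff.1 h0
    simpa [f, hV0] using h1
  refine isQuantumVariable_of_deficiency hD (fun ψ χ => ?_)
    (hdef Complex.I (-1) (by simp) (by norm_num))
    (hdef (-Complex.I) 1 (by simp) (by norm_num))
  -- Symmetry comes from differentiating the constant function `⟪V t ψ, V t χ⟫` at `0`.
  have h := (hV 0 ψ).inner ℂ (hV 0 χ)
  simp only [hVinner, hV0] at h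
  have h1 := h.unique (hasDerivAt_const _ _)
  rw [inner_smul_left, inner_smul_right, Complex.conj_I] at h1
  have h2 : Complex.I * (⟪(ψ : H), S χ⟫_ℂ - ⟪S ψ, (χ : H)⟫_ℂ) = 0 := by
    linear_combination h1
  rcases mul_eq_zero.1 h2 with h3 | h3
  · exact absurd h3 Complex.I_ne_zero
  · exact (sub_eq_zero.1 h3).symm

end EssentialSelfAdjointness

/-! ### Exponential vectors, displacement operators and their generators. -/

section FockOperators

variable {E : Type*} [NormedAddCommGroup E] [InnerProductSpace ℂ E]

/-- The exponential vector of `g` as an element of the exponential domain. -/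
def expDomainVec (g : E) : expDomain E := ⟨expVec g, Submodule.subset_span ⟨g, rfl⟩⟩

theorem expDomain_induction {p : expDomain E → Prop} (hexp : ∀ g, p (expDomainVec g))
    (hadd : ∀ u v, p u → p v → p (u + v)) (hsmul : ∀ (c : ℂ) v, p v → p (c • v))
    (v : expDomain E) : p v := by
  obtain ⟨v, hv⟩ := v
  induction hv using Submodule.span_induction with
  | mem x hx => obtain ⟨g, rfl⟩ := hx; exact hexp g
  | zero =>
    have h := hsmul 0 _ (hexp 0)
    rw [zero_smul] at h
    exact h
  | add x y hx hy h1 h2 => exact hadd _ _ h1 h2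
  | smul c x hx h => exact hsmul c _ h

/-- The linear map on the exponential domain with prescribed values on exponential vectors. -/
def expLift {K : Type*} [AddCommGroup K] [Module ℂ K] (F : E → K) : expDomain E →ₗ[ℂ] K :=
  Finsupp.linearCombination ℂ F ∘ₗ linearIndependent_expVec.repr

theorem expLift_expDomainVec {K : Type*} [AddCommGroup K] [Module ℂ K] (F : E → K) (g : E) :
    expLift F (expDomainVec g) = F g := by
  have h : linearIndependent_expVec.repr (expDomainVec g) = Finsupp.single g 1 :=
    linearIndependent_expVec.repr_eq_single g _ rfl
  change Finsupp.linearCombination ℂ F (linearIndependent_expVec.repr (expDomainVec g)) = F g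
  rw [h]
  simp

theorem fieldOp_expDomainVec (h g : E) :
    fieldOp h (expDomainVec g) = ⟪h, g⟫_ℂ • expVec g + fderiv ℂ expVec g h :=
  congrArg₂ (· + ·) (expLift_expDomainVec (fun g => ⟪h, g⟫_ℂ • expVec g) g)
    (expLift_expDomainVec (fun g => fderiv ℂ expVec g h) g)

theorem dense_expDomain : Dense (expDomain E : Set (FockSpace E)) := by
  have h := RKHS.kerFun_dense (𝕜 := ℂ) (H := FockSpace E)
  rw [← Submodule.dense_iff_topologicalClosure_eq_top] at h
  refine h.mono (Submodule.span_le.2 ?_)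
  rintro _ ⟨g, c, rfl⟩
  have h1 : RKHS.kerFun (FockSpace E) g c = c • expVec g := by
    rw [expVec, ← map_smul, smul_eq_mul, mul_one]
  rw [h1]
  exact Submodule.smul_mem _ c (expDomainVec g).2

/-- Since exponential vectors span the domain, matching their Gram kernel is enough for a linear
extension to be isometric. -/
theorem expLift_inner {K : Type*} [NormedAddCommGroup K] [InnerProductSpace ℂ K] {F : E → K}
    (hF : ∀ f g, ⟪F f, F g⟫_ℂ = Complex.exp ⟪f, g⟫_ℂ) (u v : expDomain E) :
    ⟪expLift F u, expLift F v⟫_ℂ = ⟪u, v⟫_ℂ := by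
  induction u using expDomain_induction with
  | hexp f =>
    induction v using expDomain_induction with
    | hexp g =>
      rw [expLift_expDomainVec, expLift_expDomainVec, hF]
      exact (inner_expVec f g).symm
    | hadd u v hu hv => rw [map_add, inner_add_right, inner_add_right, hu, hv]
    | hsmul c v hv => rw [map_smul, inner_smul_right, inner_smul_right, hv]
  | hadd u v hu hv => rw [map_add, inner_add_left, inner_add_left, hu, hv]
  | hsmul c v hv => rw [map_smul, inner_smul_left, inner_smul_left, hv]

/-- The projection to the one-particle space is a contraction. -/
theorem norm_expLift_id_le (v : expDomain E) : ‖expLift (id : E → E) v‖ ≤ ‖v‖ := by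
  set c := linearIndependent_expVec.repr v with hc
  have hv : (v : FockSpace E) = c.sum fun g b => b • expVec g :=
    (linearIndependent_expVec.linearCombination_repr v).symm
  have hQ : expLift (id : E → E) v = c.sum fun g b => b • g := rfl
  have hsum : ∀ {K : Type _} [NormedAddCommGroup K] [InnerProductSpace ℂ K] (F : E → K),
      ‖c.sum fun g b => b • F g‖ ^ 2
        = (c.sum fun f a => c.sum fun g b => conj a * ⟪F f, F g⟫_ℂ * b).re := by
    intro K _ _ F
    rw [← inner_self_eq_norm_sq (𝕜 := ℂ)]
    simp only [Finsupp.sum, sum_inner, inner_sum, inner_smul_left, inner_smul_right, Finset.mul_sum]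
    rw [Finset.sum_comm]
    change Complex.re _ = Complex.re _
    congr 1
    refine Finset.sum_congr rfl fun f _ => Finset.sum_congr rfl fun g _ => by ring
  have key : ∀ f g : E, HasSum
      (fun n : ℕ => ((n.factorial : ℝ))⁻¹ * (conj (c f) * ⟪f, g⟫_ℂ ^ n * c g).re)
      (conj (c f) * Complex.exp ⟪f, g⟫_ℂ * c g).re := by
    intro f g
    have h := NormedSpace.expSeries_div_hasSum_exp (𝔸 := ℂ) ⟪f, g⟫_ℂ
    rw [← Complex.exp_eq_exp_ℂ] at h
    have h2 := Complex.hasSum_re ((h.mul_left (conj (c f))).mul_right (c g))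
    convert h2 using 2 with n
    rw [← Complex.re_ofReal_mul]
    congr 1
    push_cast
    ring
  have h1 : HasSum (fun n : ℕ => ((n.factorial : ℝ))⁻¹ *
      (c.sum fun f a => c.sum fun g b => conj a * ⟪f, g⟫_ℂ ^ n * b).re)
      (c.sum fun f a => c.sum fun g b => conj a * Complex.exp ⟪f, g⟫_ℂ * b).re := by
    simp only [Finsupp.sum, Complex.re_sum, Finset.mul_sum]
    exact hasSum_sum fun f _ => hasSum_sum fun g _ => key f g
  -- The squared norm of `v` is a series of nonnegative terms, one for each particle number; the
  -- term `n = 1` is the squared norm of the one-particle component.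
  have h2 := le_hasSum h1 1 fun n _ => mul_nonneg (by positivity) (powKernel_nonneg E c n)
  simp only [Nat.factorial_one, Nat.cast_one, inv_one, one_mul, pow_one] at h2
  have h3 : ‖expLift (id : E → E) v‖ ^ 2 ≤ ‖(v : FockSpace E)‖ ^ 2 := by
    rw [hQ, hv, hsum expVec]
    simp only [inner_expVec]
    exact (hsum id).trans_le h2
  exact (sq_le_sq₀ (norm_nonneg _) (norm_nonneg _)).1 h3

/-- The displacement (Weyl) operators on the exponential domain. -/
def displacement (h : E) : expDomain E →ₗ[ℂ] expDomain E :=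
  expLift fun g => Complex.exp (-((‖h‖ : ℂ) ^ 2 / 2) - ⟪h, g⟫_ℂ) • expDomainVec (g + h)

theorem displacement_expDomainVec (h g : E) : displacement h (expDomainVec g) =
    Complex.exp (-((‖h‖ : ℂ) ^ 2 / 2) - ⟪h, g⟫_ℂ) • expDomainVec (g + h) :=
  expLift_expDomainVec _ g

theorem displacement_inner (h : E) (u v : expDomain E) :
    ⟪displacement h u, displacement h v⟫_ℂ = ⟪u, v⟫_ℂ := by
  refine expLift_inner (fun f g => ?_) u v
  rw [inner_smul_left, inner_smul_right]
  change _ * (_ * ⟪expVec _, expVec _⟫_ℂ) = _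
  rw [inner_expVec, ← Complex.exp_conj, ← Complex.exp_add, ← Complex.exp_add]
  congr 1
  simp only [map_sub, map_neg, map_div₀, map_pow, Complex.conj_ofReal, inner_conj_symm,
    inner_add_left, inner_add_right, inner_self_eq_norm_sq_to_K, map_ofNat]
  simp only [Complex.coe_algebraMap]
  ring

theorem displacement_zero (v : expDomain E) : displacement (0 : E) v = v := by
  induction v using expDomain_induction with
  | hexp g => simp [displacement_expDomainVec]
  | hadd u v hu hv => rw [map_add, hu, hv]
  | hsmul c v hv => rw [map_smul, hv]

variable [CompleteSpace E]

variable (E) in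
/-- The projection of the Fock space to the one-particle space. -/
def oneParticleProj : FockSpace E →L[ℂ] E :=
  (expLift (id : E → E)).extendOfNorm (expDomain E).subtype

theorem oneParticleProj_expVec (g : E) : oneParticleProj E (expVec g) = g := by
  have h := LinearMap.extendOfNorm_eq (f := expLift (id : E → E)) (e := (expDomain E).subtype)
    (by simpa [DenseRange] using dense_expDomain)
    ⟨1, fun v => by rw [one_mul]; exact norm_expLift_id_le v⟩ (expDomainVec g)
  exact h.trans (expLift_expDomainVec _ g)

theorem norm_oneParticleProj_le : ‖oneParticleProj E‖ ≤ 1 :=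
  LinearMap.opNorm_extendOfNorm_le (by simpa [DenseRange] using dense_expDomain) zero_le_one
    fun v => by rw [one_mul]; exact norm_expLift_id_le v

/-- The derivative embeds the one-particle space as the adjoint of the one-particle projection. The
remainder has squared norm at most `exp(‖h‖²) - 1 - ‖h‖² = O(‖h‖⁴)`; only contractivity of the
embedding is needed for this. -/
theorem hasFDerivAt_expVec_zero :
    HasFDerivAt (expVec : E → FockSpace E) (oneParticleProj E).adjoint 0 := by
  rw [hasFDerivAt_iff_isLittleO_nhds_zero]
  set D := (oneParticleProj E).adjoint
  have hD : ‖D‖ ≤ 1 := by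
    rw [LinearIsometryEquiv.norm_map]
    exact norm_oneParticleProj_le
  have h1 : ∀ h : E, ‖expVec (0 + h) - expVec 0 - D h‖ ^ 2 ≤ Real.exp (‖h‖ ^ 2) - 1 - ‖h‖ ^ 2 := by
    intro h
    rw [zero_add]
    have hDn : ‖D h‖ ^ 2 ≤ ‖h‖ ^ 2 := by
      refine pow_le_pow_left₀ (norm_nonneg _) ?_ 2
      simpa using D.le_of_opNorm_le hD h
    have ha : ⟪expVec h - expVec 0, D h⟫_ℂ = ⟪h, h⟫_ℂ := by
      rw [ContinuousLinearMap.adjoint_inner_right, map_sub, oneParticleProj_expVec,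
        oneParticleProj_expVec, sub_zero]
    have hb : ‖expVec h - expVec (0 : E)‖ ^ 2 = Real.exp (‖h‖ ^ 2) - 1 := by
      rw [← inner_self_eq_norm_sq (𝕜 := ℂ)]
      simp only [inner_sub_left, inner_sub_right, inner_expVec,
        inner_zero_left, inner_zero_right, Complex.exp_zero]
      have h2 : (Complex.exp ((‖h‖ : ℂ) ^ 2)).re = Real.exp (‖h‖ ^ 2) := by
        rw [← Complex.ofReal_pow, ← Complex.ofReal_exp, Complex.ofReal_re]
      simp [inner_self_eq_norm_sq_to_K, h2]
    rw [@norm_sub_sq ℂ, ha, hb, inner_self_eq_norm_sq]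
    linarith
  have h2 : (fun x : ℝ => Real.exp x - 1 - x) =O[nhds 0] fun x => x ^ 2 := by
    have := Real.exp_sub_sum_range_isBigO_pow 2
    simpa [Finset.sum_range_succ, sub_sub] using this
  have h3 : Filter.Tendsto (fun h : E => ‖h‖ ^ 2) (nhds 0) (nhds 0) := by
    have : Continuous fun h : E => ‖h‖ ^ 2 := by fun_prop
    simpa using this.tendsto 0
  have h4 := h2.comp_tendsto h3
  have h5 : (fun h : E => ‖expVec (0 + h) - expVec 0 - D h‖ ^ 2) =O[nhds 0]
      fun h => (‖h‖ ^ 2) ^ 2 := by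
    refine Asymptotics.IsBigO.trans ?_ h4
    refine Asymptotics.IsBigO.of_bound 1 (Filter.Eventually.of_forall fun h => ?_)
    rw [one_mul, Real.norm_of_nonneg (by positivity)]
    exact (h1 h).trans (le_abs_self _)
  have h6 : (fun h : E => expVec (0 + h) - expVec 0 - D h) =O[nhds 0] fun h => ‖h‖ ^ 2 := by
    exact (Asymptotics.IsBigO.of_pow two_ne_zero h5).of_norm_left
  refine h6.trans_isLittleO ?_
  have h7 : (fun h : E => ‖h‖ ^ 2) =o[nhds 0] fun h => ‖h‖ ^ 1 :=
    (Asymptotics.isLittleO_pow_pow one_lt_two).comp_tendsto (tendsto_norm_zero)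
  exact (by simpa using h7 : (fun h : E => ‖h‖ ^ 2) =o[nhds 0] fun h => ‖h‖).of_norm_right

/-- Differentiability at `0` is transported to `g` by the displacement operator of `g`, which maps
`expVec (h - g)` to `expVec h` up to a scalar differentiable in `h`. -/
theorem differentiable_expVec : Differentiable ℂ (expVec : E → FockSpace E) := by
  intro g
  let W : FockSpace E →L[ℂ] FockSpace E :=
    ((expDomain E).subtype ∘ₗ displacement g).extendOfNorm (expDomain E).subtype
  have hW : ∀ h : E, W (expVec h) =
      Complex.exp (-((‖g‖ : ℂ) ^ 2 / 2) - ⟪g, h⟫_ℂ) • expVec (h + g) := by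
    intro h
    have := LinearMap.extendOfNorm_eq (f := (expDomain E).subtype ∘ₗ displacement g)
      (e := (expDomain E).subtype)
      (by simpa [DenseRange] using dense_expDomain)
      ⟨1, fun v => by
        rw [one_mul]
        change ‖displacement g v‖ ≤ ‖v‖
        rw [@norm_eq_sqrt_re_inner ℂ, @norm_eq_sqrt_re_inner ℂ, displacement_inner]⟩ (expDomainVec h)
    refine this.trans ?_
    rw [LinearMap.comp_apply, displacement_expDomainVec]
    rfl
  have h1 : (expVec : E → FockSpace E) = fun h =>
      Complex.exp ((‖g‖ : ℂ) ^ 2 / 2 + ⟪g, h - g⟫_ℂ) • W (expVec (h - g)) := by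
    ext1 h
    rw [hW, smul_smul, ← Complex.exp_add, sub_add_cancel]
    simp
  rw [h1]
  have h2 : DifferentiableAt ℂ (expVec : E → FockSpace E) (g - g) := by
    rw [sub_self]
    exact hasFDerivAt_expVec_zero.differentiableAt
  have h3 : DifferentiableAt ℂ (fun h => expVec (h - g)) g :=
    DifferentiableAt.comp (f := fun h : E => h - g) g h2 (by fun_prop)
  have h4 : DifferentiableAt ℂ (fun h : E => ⟪g, h - g⟫_ℂ) g := by
    have : (fun h : E => ⟪g, h - g⟫_ℂ) = fun h => innerSL ℂ g (h - g) := rfl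
    rw [this]
    fun_prop
  fun_prop

/-- The field operator generates the displacement operators. -/
theorem hasDerivAt_displacement (h : E) (v : expDomain E) (t : ℝ) :
    HasDerivAt (fun s : ℝ => (displacement (((s : ℂ) * Complex.I) • h) v : FockSpace E))
      (Complex.I • fieldOp h (displacement (((t : ℂ) * Complex.I) • h) v)) t := by
  induction v using expDomain_induction with
  | hexp g =>
    simp only [displacement_expDomainVec, map_smul, fieldOp_expDomainVec]
    change HasDerivAt (fun s : ℝ => Complex.exp _ • expVec (g + ((s : ℂ) * Complex.I) • h)) _ t
    have h1 : HasDerivAt (fun s : ℝ => g + ((s : ℂ) * Complex.I) • h) (Complex.I • h) t := by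
      have := ((Complex.ofRealCLM.hasDerivAt (x := t)).mul_const Complex.I).smul_const h
      simpa using this.const_add g
    have h2 : HasDerivAt (fun s : ℝ => expVec (g + ((s : ℂ) * Complex.I) • h))
        (fderiv ℂ expVec (g + ((t : ℂ) * Complex.I) • h) (Complex.I • h)) t := by
      exact (((differentiable_expVec _).hasFDerivAt.restrictScalars ℝ).comp_hasDerivAt t h1)
    have h3 : ∀ s : ℝ, -((‖((s : ℂ) * Complex.I) • h‖ : ℂ) ^ 2 / 2)
        - ⟪((s : ℂ) * Complex.I) • h, g⟫_ℂ
        = (s : ℂ) ^ 2 * (-(‖h‖ : ℂ) ^ 2 / 2) + s * (Complex.I * ⟪h, g⟫_ℂ) := by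
      intro s
      rw [norm_smul, norm_mul, Complex.norm_I, mul_one, Complex.norm_real, inner_smul_left]
      simp only [map_mul, Complex.conj_ofReal, Complex.conj_I, Complex.ofReal_mul, mul_pow]
      rw [← Complex.ofReal_pow ‖s‖, Real.norm_eq_abs, sq_abs]
      push_cast
      ring
    have h4 : HasDerivAt (fun s : ℝ => Complex.exp (-((‖((s : ℂ) * Complex.I) • h‖ : ℂ) ^ 2 / 2)
        - ⟪((s : ℂ) * Complex.I) • h, g⟫_ℂ))
        (Complex.exp (-((‖((t : ℂ) * Complex.I) • h‖ : ℂ) ^ 2 / 2)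
        - ⟪((t : ℂ) * Complex.I) • h, g⟫_ℂ) * (-t * (‖h‖ : ℂ) ^ 2 + Complex.I * ⟪h, g⟫_ℂ)) t := by
      simp only [h3]
      have h5 := ((((hasDerivAt_id (t : ℂ)).pow 2).mul_const (-(‖h‖ : ℂ) ^ 2 / 2)).add
        ((hasDerivAt_id (t : ℂ)).mul_const (Complex.I * ⟪h, g⟫_ℂ))).cexp.comp_ofReal
      refine h5.congr_deriv ?_
      simp
      ring
    refine (h4.smul h2).congr_deriv ?_
    -- The derivative `-t‖h‖²` of the Gaussian factor is exactly what `i⟪h, ·⟫` contributes on the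
    -- shift `t i h` of the argument, because `i · i = -1`.
    rw [map_smul, inner_add_right, inner_smul_right, inner_self_eq_norm_sq_to_K]
    simp only [smul_add, smul_smul, Complex.coe_algebraMap]
    rw [add_comm]
    congr 1
    · congr 1
      linear_combination (-Complex.exp (-((‖((t : ℂ) * Complex.I) • h‖ : ℂ) ^ 2 / 2)
        - ⟪((t : ℂ) * Complex.I) • h, g⟫_ℂ) * t * (‖h‖ : ℂ) ^ 2) * Complex.I_sq
    · congr 1
      ring
  | hadd u v hu hv =>
    simp only [map_add, Submodule.coe_add, smul_add]
    exact hu.add hv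
  | hsmul c v hv =>
    simp only [map_smul, Submodule.coe_smul]
    rw [smul_comm]
    exact hv.const_smul c

end FockOperators

/-! ### Weyl relations on the initial space: generators and their common domain. -/

section WeylSystem

variable {H : Type*} [NormedAddCommGroup H] [InnerProductSpace ℂ H]

/-- Product rule for a strongly continuous family of contractions applied to a path. -/
theorem hasDerivAt_clm_apply_zero {V : ℝ → H →L[ℂ] H} (hV0 : V 0 = 1) (hV : ∀ t ψ, ‖V t ψ‖ ≤ ‖ψ‖)
    (hVc : ∀ ψ, Continuous fun t => V t ψ) {y : ℝ → H} {u v w : H} (hy0 : y 0 = u)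
    (hVu : HasDerivAt (fun t => V t u) v 0) (hy : HasDerivAt y w 0) :
    HasDerivAt (fun t => V t (y t)) (v + w) 0 := by
  -- Write `y t = u + t w + o(t)`. The family is not assumed differentiable on `w`: strong
  -- continuity suffices because of the prefactor `t`, and contractivity keeps the remainder `o(t)`.
  have hw : HasDerivAt (fun t : ℝ => t • V t w) w 0 := by
    have h1 : HasDerivAt (fun t : ℝ => t • w) w 0 := by
      simpa using (hasDerivAt_id (0 : ℝ)).smul_const w
    rw [hasDerivAt_iff_isLittleO_nhds_zero]
    simp only [zero_add, zero_smul, sub_zero, ← smul_sub]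
    have h2 : (fun t : ℝ => V t w - w) =o[nhds 0] fun _ : ℝ => (1 : ℝ) := by
      rw [Asymptotics.isLittleO_one_iff]
      have h : Continuous fun t => V t w - w := (hVc w).sub continuous_const
      simpa [hV0] using h.tendsto 0
    have h3 := (Asymptotics.isBigO_refl (fun t : ℝ => t) (nhds 0)).smul_isLittleO h2
    simpa using h3
  have hr : HasDerivAt (fun t : ℝ => V t (y t - u - t • w)) 0 0 := by
    rw [hasDerivAt_iff_isLittleO_nhds_zero] at hy ⊢
    simp only [zero_add, hy0, sub_self, zero_smul, map_zero, smul_zero, sub_zero] at hy ⊢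
    refine Asymptotics.IsBigO.trans_isLittleO (Asymptotics.IsBigO.of_bound 1 ?_) hy
    exact Filter.Eventually.of_forall fun t => by rw [one_mul]; exact hV t _
  have h := (hVu.add hw).add hr
  rw [add_zero] at h
  refine h.congr_of_eventuallyEq (Filter.Eventually.of_forall fun t => ?_)
  have h1 : t • V t w = V t (t • w) := ((V t).map_smul_of_tower t w).symm
  change V t (y t) = V t u + t • V t w + V t (y t - u - t • w)
  rw [h1, ← map_add, ← map_add]
  congr 1
  abel

variable [CompleteSpace H] {n : ℕ}

/-- A strongly continuous unitary representation of the Weyl relations. -/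
structure IsWeylSystem (Θ : Matrix (Fin n) (Fin n) ℝ) (U : (Fin n → ℝ) → H →L[ℂ] H) : Prop where
  unitary : ∀ u, U u ∈ unitary (H →L[ℂ] H)
  continuous : ∀ ψ, Continuous fun u => U u ψ
  mul : ∀ u v, U u * U v = Complex.exp (-Complex.I * ((u ⬝ᵥ Θ *ᵥ v : ℝ) : ℂ)) • U (u + v)

theorem dotProduct_mulVec_skew {Θ : Matrix (Fin n) (Fin n) ℝ} (hΘ : Θᵀ = -Θ) (u v : Fin n → ℝ) :
    v ⬝ᵥ Θ *ᵥ u = -(u ⬝ᵥ Θ *ᵥ v) := by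
  rw [Matrix.dotProduct_mulVec, ← Matrix.mulVec_transpose, hΘ, Matrix.neg_mulVec, neg_dotProduct,
    dotProduct_comm]

theorem dotProduct_mulVec_self_skew {Θ : Matrix (Fin n) (Fin n) ℝ} (hΘ : Θᵀ = -Θ)
    (u : Fin n → ℝ) : u ⬝ᵥ Θ *ᵥ u = 0 := by
  have := dotProduct_mulVec_skew hΘ u u
  linarith

namespace IsWeylSystem

variable {Θ : Matrix (Fin n) (Fin n) ℝ} {U : (Fin n → ℝ) → H →L[ℂ] H}

theorem inner_map (hU : IsWeylSystem Θ U) (u : Fin n → ℝ) (ψ χ : H) :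
    ⟪U u ψ, U u χ⟫_ℂ = ⟪ψ, χ⟫_ℂ := by
  have h := (Unitary.mem_iff.1 (hU.unitary u)).1
  rw [ContinuousLinearMap.star_eq_adjoint] at h
  rw [← ContinuousLinearMap.adjoint_inner_left, ← mul_apply_eq_comp, h]
  rfl

theorem norm_map (hU : IsWeylSystem Θ U) (u : Fin n → ℝ) (ψ : H) : ‖U u ψ‖ = ‖ψ‖ := by
  rw [@norm_eq_sqrt_re_inner ℂ, hU.inner_map, ← @norm_eq_sqrt_re_inner ℂ]

theorem map_zero (hU : IsWeylSystem Θ U) : U 0 = 1 := by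
  have h1 := hU.mul 0 0
  simp only [zero_dotProduct, Complex.ofReal_zero, mul_zero, Complex.exp_zero, one_smul,
    add_zero] at h1
  have h2 := (Unitary.mem_iff.1 (hU.unitary 0)).1
  calc U 0 = star (U 0) * U 0 * U 0 := by rw [h2, one_mul]
    _ = 1 := by rw [mul_assoc, h1, h2]

theorem map_add (hU : IsWeylSystem Θ U) (u v : Fin n → ℝ) (ψ : H) :
    U (u + v) ψ = Complex.exp (Complex.I * ((u ⬝ᵥ Θ *ᵥ v : ℝ) : ℂ)) • U u (U v ψ) := by
  rw [← mul_apply_eq_comp, hU.mul, smul_apply, smul_smul,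
    ← Complex.exp_add]
  simp

/-- Exchanging the factors doubles the Weyl phase by antisymmetry. Being a scalar smooth in `u` and
`v`, this phase does not affect questions of differentiability. -/
theorem map_comm (hU : IsWeylSystem Θ U) (hΘ : Θᵀ = -Θ) (u v : Fin n → ℝ) (ψ : H) :
    U u (U v ψ) = Complex.exp (-2 * Complex.I * ((u ⬝ᵥ Θ *ᵥ v : ℝ) : ℂ)) • U v (U u ψ) := by
  have h1 := hU.map_add v u ψ
  rw [add_comm v u, hU.map_add u v, dotProduct_mulVec_skew hΘ u v] at h1
  have h2 : U u (U v ψ) = Complex.exp (-Complex.I * ((u ⬝ᵥ Θ *ᵥ v : ℝ) : ℂ)) •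
      Complex.exp (Complex.I * ((u ⬝ᵥ Θ *ᵥ v : ℝ) : ℂ)) • U u (U v ψ) := by
    rw [smul_smul, ← Complex.exp_add]
    simp
  rw [h2, h1, smul_smul, ← Complex.exp_add]
  congr 2
  push_cast
  ring

/-- The domain of the generator of `t ↦ U (t a)` is invariant under the Weyl operators. -/
theorem differentiableAt_map (hU : IsWeylSystem Θ U) (hΘ : Θᵀ = -Θ) {a : Fin n → ℝ} {ψ : H}
    (hψ : DifferentiableAt ℝ (fun t : ℝ => U (t • a) ψ) 0) (v : Fin n → ℝ) :
    DifferentiableAt ℝ (fun t : ℝ => U (t • a) (U v ψ)) 0 := by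
  simp only [hU.map_comm hΘ _ v, smul_dotProduct, smul_eq_mul]
  have h1 : DifferentiableAt ℝ (fun t : ℝ => U v (U (t • a) ψ)) 0 :=
    ((U v).restrictScalars ℝ).differentiableAt.comp (0 : ℝ) hψ
  have h2 : DifferentiableAt ℝ (fun t : ℝ =>
      Complex.exp (-2 * Complex.I * ((t * (a ⬝ᵥ Θ *ᵥ v) : ℝ) : ℂ))) 0 := by
    have : Differentiable ℝ (fun t : ℝ => ((t * (a ⬝ᵥ Θ *ᵥ v) : ℝ) : ℂ)) :=
      Complex.ofRealCLM.differentiable.comp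
        (differentiable_id.mul_const (a ⬝ᵥ Θ *ᵥ v))
    fun_prop
  exact h2.smul h1

/-- On a line the Weyl phase vanishes, since `a ⬝ᵥ Θ *ᵥ a = 0` for antisymmetric `Θ`; thus each
direction gives a genuine one-parameter group. -/
theorem map_smul_add (hU : IsWeylSystem Θ U) (hΘ : Θᵀ = -Θ) (a : Fin n → ℝ) (s t : ℝ) (ψ : H) :
    U ((s + t) • a) ψ = U (s • a) (U (t • a) ψ) := by
  rw [add_smul, hU.map_add, smul_dotProduct, Matrix.mulVec_smul, dotProduct_smul,
    dotProduct_mulVec_self_skew hΘ]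
  simp

theorem hasDerivAt_of_zero (hU : IsWeylSystem Θ U) (hΘ : Θᵀ = -Θ) {a : Fin n → ℝ} {ψ ψ' : H}
    {t : ℝ} (hψ : HasDerivAt (fun s : ℝ => U (s • a) (U (t • a) ψ)) ψ' 0) :
    HasDerivAt (fun s : ℝ => U (s • a) ψ) ψ' t := by
  have h1 : HasDerivAt (fun s : ℝ => U (s • a) (U (t • a) ψ)) ψ' (t - t) := by rwa [sub_self]
  have h2 := h1.comp_sub_const t t
  refine h2.congr_of_eventuallyEq (Filter.Eventually.of_forall fun s => ?_)
  change U (s • a) ψ = U ((s - t) • a) (U (t • a) ψ)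
  rw [← hU.map_smul_add hΘ, sub_add_cancel]

/-- On the common domain, the generator in the direction `∑ aⱼ eⱼ` is the linear combination of the
generators in the coordinate directions. -/
theorem hasDerivAt_sum (hU : IsWeylSystem Θ U) (a : Fin n → ℝ) {ψ : H} {ψ' : Fin n → H}
    (hψ : ∀ j, HasDerivAt (fun t : ℝ => U (t • Pi.single j 1) ψ) (ψ' j) 0) :
    HasDerivAt (fun t : ℝ => U (t • a) ψ) (∑ j, a j • ψ' j) 0 := by
  have key : ∀ s : Finset (Fin n), HasDerivAt
      (fun t : ℝ => U (t • ∑ j ∈ s, Pi.single j (a j)) ψ) (∑ j ∈ s, a j • ψ' j) 0 := by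
    intro s
    induction s using Finset.induction_on with
    | empty => simpa using hasDerivAt_const (0 : ℝ) (U 0 ψ)
    | insert j s hj ih =>
      simp only [Finset.sum_insert hj, smul_add, hU.map_add, smul_dotProduct, Matrix.mulVec_smul,
        dotProduct_smul]
      set c := (Pi.single j (a j) : Fin n → ℝ) ⬝ᵥ Θ *ᵥ ∑ j ∈ s, Pi.single j (a j)
      have h1 : HasDerivAt (fun t : ℝ => U (t • Pi.single j (a j)) ψ) (a j • ψ' j) 0 := by
        have h2 : HasDerivAt (fun t : ℝ => U (t • Pi.single j 1) ψ) (ψ' j) (0 * a j) := by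
          rw [zero_mul]; exact hψ j
        have h3 := HasDerivAt.scomp (0 : ℝ) h2 ((hasDerivAt_id (0 : ℝ)).mul_const (a j))
        rw [one_mul] at h3
        refine h3.congr_of_eventuallyEq (Filter.Eventually.of_forall fun t => ?_)
        change U (t • Pi.single j (a j)) ψ = U ((t * a j) • Pi.single j 1) ψ
        congr 2
        rw [← Pi.single_smul, ← Pi.single_smul]
        simp
      have h4 := hasDerivAt_clm_apply_zero (V := fun t : ℝ => U (t • Pi.single j (a j)))
        (y := fun t : ℝ => U (t • ∑ j ∈ s, Pi.single j (a j)) ψ) (by simp [hU.map_zero])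
        (fun t ψ => (hU.norm_map _ _).le) (fun ψ => (hU.continuous ψ).comp (by fun_prop))
        (by simp [hU.map_zero]) h1 ih
      -- The phase from splitting off one direction is quadratic in `t`, hence invisible to the
      -- first derivative at `0`.
      have h5 : HasDerivAt (fun t : ℝ => Complex.exp (Complex.I * ((t • t • c : ℝ) : ℂ))) 0 0 := by
        have : HasDerivAt (fun t : ℂ => Complex.exp (Complex.I * (t * (t * c)))) 0 ((0 : ℝ) : ℂ) := by
          have := (((hasDerivAt_id ((0 : ℝ) : ℂ)).mul ((hasDerivAt_id ((0 : ℝ) : ℂ)).mul_const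
            (c : ℂ))).const_mul Complex.I).cexp
          simpa using this
        simpa using this.comp_ofReal
      refine (h5.smul h4).congr_deriv ?_
      simp
  have h1 := key Finset.univ
  have h2 : (∑ j, Pi.single j (a j) : Fin n → ℝ) = a := Finset.univ_sum_single a
  rwa [h2] at h1

/-- The common domain of the generators in the coordinate directions is dense. -/
theorem exists_differentiableAt (hU : IsWeylSystem Θ U) (hΘ : Θᵀ = -Θ) (e : Fin n → Fin n → ℝ)
    (s : Finset (Fin n)) (ψ : H) {ε : ℝ} (hε : 0 < ε) :
    ∃ χ : H, dist χ ψ < ε ∧ ∀ k ∈ s, DifferentiableAt ℝ (fun t : ℝ => U (t • e k) χ) 0 := by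
  induction s using Finset.induction_on generalizing ε with
  | empty => exact ⟨ψ, by simpa using hε, by simp⟩
  | insert j s hj ih =>
    obtain ⟨z, hz, hzs⟩ := ih (half_pos hε)
    have hcont : ∀ (ψ : H) (k : Fin n), Continuous fun t : ℝ => U (t • e k) ψ := fun ψ k =>
      (hU.continuous ψ).comp (by fun_prop)
    -- Gårding averaging, one direction at a time: `δ⁻¹ ∫_0^δ U(r e_j) z dr` is close to `z` for
    -- small `δ` and differentiable along `e_j`. It remains to see that averaging preserves
    -- differentiability in the directions already treated.
    let G : ℝ → H := fun x => ∫ r in (0 : ℝ)..x, U (r • e j) z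
    have hG : ∀ x, HasDerivAt G (U (x • e j) z) x := fun x =>
      intervalIntegral.integral_hasDerivAt_right ((hcont z j).intervalIntegrable _ _)
        ((hcont z j).stronglyMeasurableAtFilter _ _) (hcont z j).continuousAt
    have hlim := (hG 0).tendsto_slope_zero
    simp only [zero_smul, hU.map_zero, zero_add] at hlim
    have hG0 : G 0 = 0 := intervalIntegral.integral_same
    rw [hG0] at hlim
    obtain ⟨δ, hδ, hδ0⟩ := ((hlim.eventually (Metric.ball_mem_nhds _ (half_pos hε))).and
      self_mem_nhdsWithin).exists
    rw [sub_zero] at hδ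
    refine ⟨δ⁻¹ • G δ, ?_, fun k hk => ?_⟩
    · calc dist (δ⁻¹ • G δ) ψ ≤ dist (δ⁻¹ • G δ) z + dist z ψ := dist_triangle _ _ _
        _ < ε / 2 + ε / 2 := add_lt_add hδ hz
        _ = ε := add_halves ε
    · have hsm : (fun t : ℝ => U (t • e k) (δ⁻¹ • G δ)) = fun t => δ⁻¹ • U (t • e k) (G δ) := by
        funext t
        exact (U (t • e k)).map_smul_of_tower _ _
      rw [hsm]
      refine DifferentiableAt.const_smul ?_ _
      have hint : ∀ t : ℝ, U (t • e k) (G δ)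
          = ∫ r in (0 : ℝ)..δ, U (t • e k) (U (r • e j) z) := fun t =>
        ((U (t • e k)).intervalIntegral_comp_comm ((hcont z j).intervalIntegrable _ _)).symm
      rcases Finset.mem_insert.1 hk with rfl | hks
      -- In the new direction the group law shifts the interval of integration, leaving a difference
      -- of primitives.
      · have h1 : (fun t : ℝ => U (t • e k) (G δ)) = fun t => G (t + δ) - G t := by
          funext t
          rw [hint]
          simp only [← hU.map_smul_add hΘ]
          rw [intervalIntegral.integral_comp_add_left (fun r => U (r • e k) z), add_zero]
          exact (intervalIntegral.integral_interval_sub_left ((hcont z k).intervalIntegrable _ _)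
            ((hcont z k).intervalIntegrable _ _)).symm
        rw [h1]
        exact (((hG _).comp_add_const 0 δ).sub (hG 0)).differentiableAt
      -- In an old direction, `U(t e_k)` is commuted past `U(r e_j)` at the cost of the phase `ph t
      -- r`. It then acts on `z`, where it is differentiable, and one differentiates under the
      -- integral.
      · let c : ℝ := e k ⬝ᵥ Θ *ᵥ e j
        let Z : ℝ → H := fun t => U (t • e k) z
        let z' : H := deriv Z 0
        have hZ0 : HasDerivAt Z z' 0 := (hzs k hks).hasDerivAt
        have hZ : ∀ t, HasDerivAt Z (U (t • e k) z') t := by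
          intro t
          refine hU.hasDerivAt_of_zero hΘ ?_
          have h1 : (fun s : ℝ => U (s • e k) (U (t • e k) z)) = fun s => U (t • e k) (Z s) := by
            funext s
            rw [← hU.map_smul_add hΘ, add_comm, hU.map_smul_add hΘ]
          rw [h1]
          exact (((U (t • e k)).restrictScalars ℝ).hasFDerivAt).comp_hasDerivAt (0 : ℝ) hZ0
        let ph : ℝ → ℝ → ℂ := fun t r => Complex.exp (-2 * Complex.I * ((t * (r * c) : ℝ) : ℂ))
        have hph : ∀ t r, HasDerivAt (fun t => ph t r) (ph t r * (-2 * Complex.I * (r * c))) t := by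
          intro t r
          have := ((hasDerivAt_id (t : ℂ)).mul_const ((r * c : ℝ) : ℂ)).const_mul
            (-2 * Complex.I)
          have := this.cexp.comp_ofReal
          simpa [ph] using this
        have hphn : ∀ t r, ‖ph t r‖ = 1 := by
          intro t r
          simp [ph, Complex.norm_exp]
        have hphc : ∀ t, Continuous fun r => ph t r := by
          intro t
          simp only [ph]
          fun_prop
        have hF : (fun t : ℝ => U (t • e k) (G δ))
            = fun t => ∫ r in (0 : ℝ)..δ, ph t r • U (r • e j) (Z t) := by
          funext t
          rw [hint]
          congr 1
          funext r
          rw [hU.map_comm hΘ, smul_dotProduct, Matrix.mulVec_smul, dotProduct_smul]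
          rfl
        rw [hF]
        refine (intervalIntegral.hasDerivAt_integral_of_dominated_loc_of_deriv_le
          (F' := fun t r => ph t r • U (r • e j) (U (t • e k) z')
            + (ph t r * (-2 * Complex.I * (r * c))) • U (r • e j) (Z t))
          (bound := fun r => ‖z'‖ + 2 * |r * c| * ‖z‖) (Metric.ball_mem_nhds (0 : ℝ) one_pos)
          (Filter.Eventually.of_forall fun t =>
            ((hphc t).smul (hcont _ j)).aestronglyMeasurable)
          (((hphc 0).smul (hcont _ j)).intervalIntegrable _ _) ?_ ?_ ?_ ?_).2.differentiableAt
        · refine Continuous.aestronglyMeasurable ?_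
          exact ((hphc 0).smul (hcont _ j)).add (((hphc 0).mul (by fun_prop)).smul (hcont _ j))
        · refine Filter.Eventually.of_forall fun r _ t _ => ?_
          refine (norm_add_le _ _).trans ?_
          rw [norm_smul, norm_smul, norm_mul, hphn, hU.norm_map, hU.norm_map, hU.norm_map,
            hU.norm_map]
          simp [abs_mul]
        · exact Continuous.intervalIntegrable (by fun_prop) _ _
        · refine Filter.Eventually.of_forall fun r _ t _ => ?_
          have h1 := (hph t r).smul
            (((U (r • e j)).restrictScalars ℝ).hasFDerivAt.comp_hasDerivAt t (hZ t))
          exact h1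

end IsWeylSystem

variable {X₀ : Fin n → H →ₗ.[ℂ] H} {Θ : Matrix (Fin n) (Fin n) ℝ}

/-- The linear combination of the initial variables on their common domain. -/
def initialComb (X₀ : Fin n → H →ₗ.[ℂ] H) (a : Fin n → ℝ) : initialDomain X₀ →ₗ[ℂ] H :=
  ∑ j, (a j : ℂ) • ((X₀ j).toFun ∘ₗ Submodule.inclusion (iInf_le _ j))

omit [CompleteSpace H] in
theorem hasDerivAt_stoneGenerator {S : H →ₗ.[ℂ] H} {V : ℝ → H →L[ℂ] H} (h : S = stoneGenerator V)
    {ψ : H}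
    (hψ : ψ ∈ S.domain) : HasDerivAt (fun t => V t ψ) (Complex.I • S ⟨ψ, hψ⟩) 0 := by
  subst h
  have h1 : DifferentiableAt ℝ (fun t => V t ψ) 0 := hψ
  refine h1.hasDerivAt.congr_deriv ?_
  change _ = Complex.I • (-Complex.I • deriv (fun t => V t ψ) 0)
  simp [smul_smul]

omit [CompleteSpace H] in
theorem mem_initialDomain_iff {U : (Fin n → ℝ) → H →L[ℂ] H}
    (hX : ∀ j, X₀ j = stoneGenerator fun t => U (Pi.single j t)) (ψ : H) :
    ψ ∈ initialDomain X₀ ↔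
      ∀ j, DifferentiableAt ℝ (fun t : ℝ => U (t • (Pi.single j 1 : Fin n → ℝ)) ψ) 0 := by
  simp only [initialDomain, Submodule.mem_iInf, ← Pi.single_smul, smul_eq_mul, mul_one, hX]
  rfl

theorem dense_initialDomain (hΘ : Θᵀ = -Θ) (hX₀ : SatisfiesWeylCCR Θ X₀) :
    Dense (initialDomain X₀ : Set H) := by
  obtain ⟨U, h1, h2, h3, h4⟩ := hX₀
  have hU : IsWeylSystem Θ U := ⟨h1, h2, h3⟩
  refine Metric.dense_iff.2 fun ψ r hr => ?_
  obtain ⟨χ, hχ, hχ'⟩ := hU.exists_differentiableAt hΘ (fun j => Pi.single j 1) Finset.univ ψ hr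
  exact ⟨χ, hχ, (mem_initialDomain_iff h4 χ).2 fun j => hχ' j (Finset.mem_univ j)⟩

/-- Real linear combinations of the initial variables generate isometries of the initial domain. -/
theorem exists_isometry_initialComb (hΘ : Θᵀ = -Θ) (hX₀ : SatisfiesWeylCCR Θ X₀)
    (a : Fin n → ℝ) : ∃ V : ℝ → initialDomain X₀ →ₗᵢ[ℂ] initialDomain X₀, (∀ ψ, V 0 ψ = ψ) ∧
      ∀ t ψ, HasDerivAt (fun s => (V s ψ : H)) (Complex.I • initialComb X₀ a (V t ψ)) t := by
  obtain ⟨U, h1, h2, h3, h4⟩ := hX₀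
  have hU : IsWeylSystem Θ U := ⟨h1, h2, h3⟩
  have hinv : ∀ v, ∀ ψ ∈ initialDomain X₀, U v ψ ∈ initialDomain X₀ := fun v ψ hψ =>
    (mem_initialDomain_iff h4 _).2 fun j =>
      hU.differentiableAt_map hΘ ((mem_initialDomain_iff h4 ψ).1 hψ j) v
  refine ⟨fun t => ⟨(U (t • a)).toLinearMap.restrict (hinv (t • a)),
    fun ψ => hU.norm_map _ _⟩, fun ψ => ?_, fun t ψ => ?_⟩
  · refine Subtype.ext ?_
    change U ((0 : ℝ) • a) (ψ : H) = ψ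
    rw [zero_smul, hU.map_zero]
    rfl
  · refine hU.hasDerivAt_of_zero hΘ ?_
    have hmem := hinv (t • a) ψ ψ.2
    have h5 := hU.hasDerivAt_sum a (ψ := U (t • a) ψ)
      (ψ' := fun j => Complex.I • X₀ j ⟨U (t • a) ψ, (Submodule.mem_iInf _).1 hmem j⟩) fun j => by
        have := hasDerivAt_stoneGenerator (h4 j) ((Submodule.mem_iInf _).1 hmem j)
        simpa only [← Pi.single_smul, smul_eq_mul, mul_one] using this
    refine h5.congr_deriv ?_
    simp only [initialComb, LinearMap.sum_apply, Finset.smul_sum]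
    refine Finset.sum_congr rfl fun j _ => ?_
    rw [smul_comm]
    rfl

end WeylSystem

/-! ### The tensor product domain and sums of system and field operators. -/

section TensorDomain

variable {H₀ : Type*} [NormedAddCommGroup H₀] [InnerProductSpace ℂ H₀]
variable {E : Type*} [NormedAddCommGroup E] [InnerProductSpace ℂ E]

theorem toSystemField_apply (x : H₀ ⊗[ℂ] FockSpace E) :
    toSystemField H₀ E x = (x : SystemFieldSpace H₀ E) := rfl

theorem inner_tensorDomainEquiv (P : Submodule ℂ H₀) (x y : P ⊗[ℂ] expDomain E) :
    ⟪(tensorDomainEquiv E P x : SystemFieldSpace H₀ E), tensorDomainEquiv E P y⟫_ℂ = ⟪x, y⟫_ℂ := by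
  change ⟪toSystemField H₀ E (TensorProduct.mapIncl P (expDomain E) x),
    toSystemField H₀ E (TensorProduct.mapIncl P (expDomain E) y)⟫_ℂ = _
  rw [toSystemField_apply, toSystemField_apply, UniformSpace.Completion.inner_coe,
    TensorProduct.inner_mapIncl_mapIncl]

/-- Joint continuity of the tensor product and density of both factors put every simple tensor in
the closure; simple tensors span a dense subspace of the completion. -/
theorem dense_tensorDomain {P : Submodule ℂ H₀} (hP : Dense (P : Set H₀)) :
    Dense (tensorDomain E P : Set (SystemFieldSpace H₀ E)) := by
  have hmem : ∀ (u : H₀) (v : FockSpace E),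
      toSystemField H₀ E (u ⊗ₜ v) ∈ (tensorDomain E P).topologicalClosure := by
    intro u v
    have hc : Continuous fun z : H₀ × FockSpace E => toSystemField H₀ E (z.1 ⊗ₜ z.2) :=
      (UniformSpace.Completion.continuous_coe _).comp TensorProduct.continuous_tmul
    have hd : Dense ((P : Set H₀) ×ˢ (expDomain E : Set (FockSpace E))) := hP.prod dense_expDomain
    have hmaps : Set.MapsTo (fun z : H₀ × FockSpace E => toSystemField H₀ E (z.1 ⊗ₜ z.2))
        ((P : Set H₀) ×ˢ (expDomain E : Set (FockSpace E)))
        (tensorDomain E P : Set (SystemFieldSpace H₀ E)) := by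
      rintro ⟨x, y⟩ ⟨hx, hy⟩
      exact ⟨(⟨x, hx⟩ : P) ⊗ₜ (⟨y, hy⟩ : expDomain E), rfl⟩
    exact hmaps.closure hc (hd (u, v))
  have hrange : ∀ x : H₀ ⊗[ℂ] FockSpace E,
      (x : SystemFieldSpace H₀ E) ∈ (tensorDomain E P).topologicalClosure := by
    intro x
    rw [← toSystemField_apply]
    induction x using TensorProduct.induction_on with
    | zero => rw [map_zero]; exact Submodule.zero_mem _
    | tmul u v => exact hmem u v
    | add x y hx hy => rw [map_add]; exact Submodule.add_mem _ hx hy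
  intro z
  exact closure_minimal (s := Set.range ((↑) : H₀ ⊗[ℂ] FockSpace E → SystemFieldSpace H₀ E))
    (t := ((tensorDomain E P).topologicalClosure : Set (SystemFieldSpace H₀ E)))
    (by rintro _ ⟨x, rfl⟩; exact hrange x) (Submodule.isClosed_topologicalClosure _)
    (UniformSpace.Completion.denseRange_coe z)

theorem systemAmpl_tensorDomainEquiv {P : Submodule ℂ H₀} (S : P →ₗ[ℂ] H₀)
    (x : P ⊗[ℂ] expDomain E) : systemAmpl S (tensorDomainEquiv E P x) =
      toSystemField H₀ E (TensorProduct.map S (expDomain E).subtype x) := by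
  simp [systemAmpl]

theorem fieldAmpl_tensorDomainEquiv (P : Submodule ℂ H₀) (S : expDomain E →ₗ[ℂ] FockSpace E)
    (x : P ⊗[ℂ] expDomain E) : fieldAmpl P S (tensorDomainEquiv E P x) =
      toSystemField H₀ E (TensorProduct.map P.subtype S x) := by
  simp [fieldAmpl]

variable [CompleteSpace E]

/-- The displacement operators as isometries of the exponential domain. -/
def displacementIsometry (h : E) : expDomain E →ₗᵢ[ℂ] expDomain E :=
  (displacement h).isometryOfInner (displacement_inner h)

/-- If `S` generates isometries of a dense domain, then `S ⊗ 1 + 1 ⊗ φ(h)` is essentially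
self-adjoint. -/
theorem isQuantumVariable_systemAmpl_add_fieldAmpl {P : Submodule ℂ H₀}
    (hP : Dense (P : Set H₀)) {S : P →ₗ[ℂ] H₀} {V : ℝ → P →ₗᵢ[ℂ] P} (hV0 : ∀ ψ, V 0 ψ = ψ)
    (hV : ∀ t ψ, HasDerivAt (fun s => (V s ψ : H₀)) (Complex.I • S (V t ψ)) t) (h : E) :
    IsQuantumVariable (systemAmpl S + fieldAmpl P (fieldOp h)) := by
  let W : ℝ → expDomain E →ₗᵢ[ℂ] expDomain E := fun t =>
    displacementIsometry (((t : ℂ) * Complex.I) • h)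
  -- The isometries of the invariant domain criterion are `V t ⊗ W t`, where `W t` is the
  -- displacement by `t i h`; the Leibniz rule on simple tensors produces the two summands of the
  -- operator.
  let Z : ℝ → P ⊗[ℂ] expDomain E →ₗ[ℂ] P ⊗[ℂ] expDomain E := fun t =>
    TensorProduct.map (V t).toLinearMap (W t).toLinearMap
  refine isQuantumVariable_of_hasDerivAt (dense_tensorDomain hP)
    (fun t ψ => tensorDomainEquiv E P (Z t ((tensorDomainEquiv E P).symm ψ))) ?_ ?_ ?_
  · intro ψ
    obtain ⟨x, rfl⟩ := (tensorDomainEquiv E P).surjective ψ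
    rw [LinearEquiv.symm_apply_apply]
    congr 1
    have h1 : (V 0).toLinearMap = LinearMap.id := LinearMap.ext hV0
    have h2 : (W 0).toLinearMap = LinearMap.id := by
      refine LinearMap.ext fun v => ?_
      change displacement ((((0 : ℝ) : ℂ) * Complex.I) • h) v = v
      simp [displacement_zero]
    simp only [Z, h1, h2, TensorProduct.map_id, LinearMap.id_apply]
  · intro t ψ χ
    obtain ⟨x, rfl⟩ := (tensorDomainEquiv E P).surjective ψ
    obtain ⟨y, rfl⟩ := (tensorDomainEquiv E P).surjective χ
    simp only [LinearEquiv.symm_apply_apply, inner_tensorDomainEquiv]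
    exact TensorProduct.inner_map_map (V t) (W t) x y
  · intro t ψ
    obtain ⟨x, rfl⟩ := (tensorDomainEquiv E P).surjective ψ
    simp only [LinearEquiv.symm_apply_apply, LinearMap.add_apply, systemAmpl_tensorDomainEquiv,
      fieldAmpl_tensorDomainEquiv]
    change HasDerivAt (fun s => toSystemField H₀ E (TensorProduct.mapIncl P (expDomain E) (Z s x)))
      _ t
    induction x using TensorProduct.induction_on with
    | zero =>
      simp only [map_zero, add_zero, smul_zero]
      exact hasDerivAt_const _ _
    | add x y hx hy =>
      simp only [map_add, smul_add] at hx hy ⊢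
      refine (hx.add hy).congr_deriv ?_
      abel
    | tmul u v =>
      let B := ContinuousLinearMap.bilinearRestrictScalars ℝ (TensorProduct.mkL ℂ H₀ (FockSpace E))
      have hB : ∀ x y, B x y = x ⊗ₜ[ℂ] y := fun _ _ => rfl
      have h1 := B.hasDerivAt_of_bilinear (fun _ => hV t u) (fun _ => hasDerivAt_displacement h v t)
      simp only [hB] at h1
      let L : H₀ ⊗[ℂ] FockSpace E →L[ℝ] SystemFieldSpace H₀ E :=
        (UniformSpace.Completion.toComplL :
          H₀ ⊗[ℂ] FockSpace E →L[ℂ] SystemFieldSpace H₀ E).restrictScalars ℝ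
      have hL : ∀ x, L x = toSystemField H₀ E x := fun _ => rfl
      have h2 := L.hasFDerivAt.comp_hasDerivAt t h1
      have h3 : Z t (u ⊗ₜ v) = V t u ⊗ₜ displacement (((t : ℂ) * Complex.I) • h) v := rfl
      rw [h3, TensorProduct.map_tmul, TensorProduct.map_tmul]
      refine h2.congr_deriv ((hL _).trans ?_)
      rw [TensorProduct.tmul_smul, ← TensorProduct.smul_tmul', ← smul_add, map_smul, add_comm,
        map_add]
      rfl

end TensorDomain

/-! ### Field operators as real linear functions of the test function. -/

section FieldMap

variable {H₀ : Type*} [NormedAddCommGroup H₀] [InnerProductSpace ℂ H₀]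
variable {E : Type*} [NormedAddCommGroup E] [InnerProductSpace ℂ E]

theorem fieldOp_add (h h' : E) : fieldOp (h + h') = fieldOp h + fieldOp h' := by
  refine LinearMap.ext fun v => ?_
  induction v using expDomain_induction with
  | hexp g =>
    simp only [LinearMap.add_apply, fieldOp_expDomainVec, inner_add_left, map_add, add_smul]
    abel
  | hadd u v hu hv => rw [map_add, map_add, hu, hv]
  | hsmul c v hv => rw [map_smul, map_smul, hv]

/-- The scalar has to be real: annihilation is conjugate linear and creation complex linear in the
test function. -/
theorem fieldOp_smul (r : ℝ) (h : E) : fieldOp (r • h) = r • fieldOp h := by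
  refine LinearMap.ext fun v => ?_
  induction v using expDomain_induction with
  | hexp g =>
    rw [RCLike.real_smul_eq_coe_smul (K := ℂ) r h,
      RCLike.real_smul_eq_coe_smul (K := ℂ) r (fieldOp h)]
    simp only [LinearMap.smul_apply, fieldOp_expDomainVec, inner_smul_left, map_smul, smul_add,
      smul_smul]
    simp
  | hadd u v hu hv => rw [map_add, map_add, hu, hv]
  | hsmul c v hv => rw [map_smul, map_smul, hv]

/-- For a fixed vector of the domain, the field operator as a real linear function of the test
function. -/
def fieldCLM (P : Submodule ℂ H₀) (ψ : tensorDomain E P) : E →L[ℝ] SystemFieldSpace H₀ E where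
  toFun h := fieldAmpl P (fieldOp h) ψ
  map_add' h h' := by
    rw [fieldOp_add]
    simp only [fieldAmpl, TensorProduct.map_add_right, LinearMap.comp_apply, LinearMap.add_apply,
      map_add]
  map_smul' r h := by
    rw [fieldOp_smul, RCLike.real_smul_eq_coe_smul (K := ℂ) r (fieldOp h), RingHom.id_apply,
      RCLike.real_smul_eq_coe_smul (K := ℂ) r (fieldAmpl P (fieldOp h) ψ)]
    simp only [fieldAmpl, TensorProduct.map_smul_right, LinearMap.comp_apply, LinearMap.smul_apply,
      map_smul]
  cont := continuous_fieldAmpl P ψ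

theorem fieldCLM_apply (P : Submodule ℂ H₀) (ψ : tensorDomain E P) (h : E) :
    fieldCLM P ψ h = fieldAmpl P (fieldOp h) ψ := rfl

variable {n μ : ℕ} {X₀ : Fin n → H₀ →ₗ.[ℂ] H₀} {Θ : Matrix (Fin n) (Fin n) ℝ}

theorem sum_smul_initialOp (a : Fin n → ℝ) :
    ∑ j, (a j : ℂ) • initialOp μ X₀ j = systemAmpl (initialComb X₀ a) := by
  refine LinearMap.ext fun ψ => ?_
  obtain ⟨x, rfl⟩ := (tensorDomainEquiv (OneParticle μ) (initialDomain X₀)).surjective ψ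
  simp only [LinearMap.sum_apply, LinearMap.smul_apply, initialOp, systemAmpl_tensorDomainEquiv,
    ← map_smul, ← map_sum]
  congr 1
  induction x using TensorProduct.induction_on with
  | zero => simp
  | add x y hx hy => simp only [map_add, smul_add, Finset.sum_add_distrib, hx, hy]
  | tmul u v =>
    simp only [TensorProduct.map_tmul, TensorProduct.smul_tmul', ← TensorProduct.sum_tmul]
    congr 1
    simp [initialComb]

/-- Real linear combinations of the initial variables and field operators are self-adjoint quantum
variables. -/
theorem isQuantumVariable_of_eq [CompleteSpace H₀] (hΘ : Θᵀ = -Θ)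
    (hX₀ : SatisfiesWeylCCR Θ X₀) (a : Fin n → ℝ) (h : OneParticle μ) {S : DomainOp μ X₀}
    (hS : ∀ ψ, S ψ = ∑ j, (a j : ℂ) • initialOp μ X₀ j ψ + fieldCLM _ ψ h) :
    IsQuantumVariable S := by
  obtain ⟨V, hV0, hV⟩ := exists_isometry_initialComb hΘ hX₀ a
  have h1 := isQuantumVariable_systemAmpl_add_fieldAmpl (dense_initialDomain hΘ hX₀) hV0 hV h
  convert h1
  refine LinearMap.ext fun ψ => ?_
  rw [hS, LinearMap.add_apply, ← sum_smul_initialOp]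
  simp [fieldCLM_apply]

end FieldMap

/-! ### Karhunen-Loeve expansion of curves with Wiener covariance. -/

section KarhunenLoeve

theorem freq_pos {T : ℝ} (hT : 0 < T) (k : ℕ) : 0 < freq T k := by
  have := Real.pi_pos
  unfold freq
  positivity

theorem freq_mul_self {T : ℝ} (hT : 0 < T) (k : ℕ) : freq T k * T = k * Real.pi + Real.pi / 2 := by
  unfold freq
  field_simp

theorem cos_freq_mul {T : ℝ} (hT : 0 < T) (k : ℕ) : Real.cos (freq T k * T) = 0 := by
  rw [freq_mul_self hT, Real.cos_add_pi_div_two, Real.sin_nat_mul_pi, neg_zero]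

theorem sin_freq_mul {T : ℝ} (hT : 0 < T) (k : ℕ) : Real.sin (freq T k * T) = (-1) ^ k := by
  rw [freq_mul_self hT, Real.sin_add_pi_div_two, Real.cos_nat_mul_pi]

theorem hasDerivAt_sineFun (T : ℝ) (k : ℕ) (t : ℝ) :
    HasDerivAt (sineFun T k) (freq T k * cosineFun T k t) t := by
  have h := (((hasDerivAt_id t).const_mul (freq T k)).sin).const_mul √(2 / T)
  refine h.congr_deriv ?_
  simp [cosineFun]
  ring

theorem hasDerivAt_cosineFun (T : ℝ) (k : ℕ) (t : ℝ) :
    HasDerivAt (cosineFun T k) (-(freq T k * sineFun T k t)) t := by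
  have h := (((hasDerivAt_id t).const_mul (freq T k)).cos).const_mul √(2 / T)
  refine h.congr_deriv ?_
  simp [sineFun]
  ring

theorem continuous_cosineFun (T : ℝ) (k : ℕ) : Continuous (cosineFun T k) := by
  unfold cosineFun
  fun_prop

/-- The integral operator with kernel `min` inverts the second derivative. -/
theorem integral_mul_min {g g' g'' : ℝ → ℝ} (h1 : ∀ t, HasDerivAt g (g' t) t)
    (h2 : ∀ t, HasDerivAt g' (g'' t) t) (hc : Continuous g'') {t T : ℝ} (ht : 0 ≤ t) (htT : t ≤ T) :
    ∫ s in (0 : ℝ)..T, g'' s * min s t = t * g' T - g t + g 0 := by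
  have hcm : Continuous fun s => g'' s * min s t := by fun_prop
  -- Split where `min s t` changes branch; on the first piece the integrand is the derivative of `g'
  -- s * s - g s`, on the second that of `g' s * t`.
  rw [← intervalIntegral.integral_add_adjacent_intervals (b := t) (hcm.intervalIntegrable _ _)
    (hcm.intervalIntegrable _ _)]
  have e1 : ∫ s in (0 : ℝ)..t, g'' s * min s t = ∫ s in (0 : ℝ)..t, g'' s * s := by
    refine intervalIntegral.integral_congr fun s hs => ?_
    rw [Set.uIcc_of_le ht] at hs
    simp only [min_eq_left hs.2]
  have e2 : ∫ s in t..T, g'' s * min s t = ∫ s in t..T, g'' s * t := by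
    refine intervalIntegral.integral_congr fun s hs => ?_
    rw [Set.uIcc_of_le htT] at hs
    simp only [min_eq_right hs.1]
  have f1 : ∫ s in (0 : ℝ)..t, g'' s * s = (g' t * t - g t) - (g' 0 * 0 - g 0) := by
    refine intervalIntegral.integral_eq_sub_of_hasDerivAt (f := fun s => g' s * s - g s)
      (fun s _ => ?_) (Continuous.intervalIntegrable (by fun_prop) _ _)
    refine (((h2 s).mul (hasDerivAt_id s)).sub (h1 s)).congr_deriv ?_
    simp
  have f2 : ∫ s in t..T, g'' s * t = g' T * t - g' t * t :=
    intervalIntegral.integral_eq_sub_of_hasDerivAt (f := fun s => g' s * t)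
      (fun s _ => (h2 s).mul_const t) (Continuous.intervalIntegrable (by fun_prop) _ _)
  rw [e1, e2, f1, f2]
  ring

/-- The eigenvalue equation of the covariance operator. The boundary terms vanish because `sin 0 =
0` and `cos (ω_k T) = 0`; the latter is the reason for the half-integers in `ω_k`. -/
theorem integral_sineFun_mul_min {T : ℝ} (hT : 0 < T) (k : ℕ) {t : ℝ} (ht : t ∈ Set.Icc 0 T) :
    ∫ s in (0 : ℝ)..T, sineFun T k s * min s t = sineFun T k t / freq T k ^ 2 := by
  have hω := (freq_pos hT k).ne'
  rw [integral_mul_min (g := fun s => -(sineFun T k s / freq T k ^ 2))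
    (g' := fun s => -(cosineFun T k s / freq T k)) (fun s => ?_) (fun s => ?_)
    (continuous_sineFun T k) ht.1 ht.2]
  · simp [cosineFun, cos_freq_mul hT, sineFun]
  · refine ((hasDerivAt_sineFun T k s).div_const _).neg.congr_deriv ?_
    field_simp
  · refine ((hasDerivAt_cosineFun T k s).div_const _).neg.congr_deriv ?_
    field_simp

theorem integral_sineFun_sq {T : ℝ} (hT : 0 < T) (k : ℕ) :
    ∫ s in (0 : ℝ)..T, sineFun T k s * sineFun T k s = 1 := by
  have hω := (freq_pos hT k).ne'
  have hc : Continuous fun s => sineFun T k s * sineFun T k s :=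
    (continuous_sineFun T k).mul (continuous_sineFun T k)
  rw [intervalIntegral.integral_eq_sub_of_hasDerivAt
    (f := fun s => s / T - sineFun T k s * cosineFun T k s / (2 * freq T k)) (fun s _ => ?_)
    (hc.intervalIntegrable _ _)]
  · simp [cosineFun, cos_freq_mul hT, sineFun, hT.ne']
  · refine (((hasDerivAt_id s).div_const T).sub (((hasDerivAt_sineFun T k s).mul
      (hasDerivAt_cosineFun T k s)).div_const _)).congr_deriv ?_
    have h : sineFun T k s * sineFun T k s + cosineFun T k s * cosineFun T k s = 2 / T := by
      have h2 : √(2 / T) * √(2 / T) = 2 / T := Real.mul_self_sqrt (by positivity)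
      simp only [sineFun, cosineFun]
      calc _ = √(2 / T) * √(2 / T)
            * (Real.sin (freq T k * s) ^ 2 + Real.cos (freq T k * s) ^ 2) := by ring
        _ = 2 / T := by rw [h2, Real.sin_sq_add_cos_sq, mul_one]
    field_simp
    field_simp at h
    linear_combination -h

/-- The Mercer expansion of the kernel `min` on the diagonal. -/
theorem hasSum_sineFun_div_freq_sq {T : ℝ} (hT : 0 < T) {t : ℝ} (ht : t ∈ Set.Icc 0 T) :
    HasSum (fun k => (sineFun T k t / freq T k) ^ 2) t := by
  -- The Fourier series of the second Bernoulli polynomial. The index `n = 0` is included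
  -- harmlessly, since `1 / 0 = 0`.
  have hS : ∀ x ∈ Set.Icc (0 : ℝ) 1, HasSum
      (fun n : ℕ => 1 / (n : ℝ) ^ 2 * Real.cos (2 * Real.pi * n * x))
      (Real.pi ^ 2 * (x ^ 2 - x + 6⁻¹)) := by
    intro x hx
    have h := hasSum_one_div_nat_pow_mul_cos one_ne_zero hx
    change HasSum _ (_ * bernoulliFun 2 x) at h
    rw [bernoulliFun_two] at h
    convert h using 1
    norm_num
    ring
  -- The even terms form a quarter of the same series at `2x`, hence the range `x ≤ 1/2`;
  -- subtracting them leaves the odd frequencies.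
  have hodd : ∀ x ∈ Set.Icc (0 : ℝ) (1 / 2), HasSum
      (fun k : ℕ => 1 / ((2 * k + 1 : ℕ) : ℝ) ^ 2
        * Real.cos (2 * Real.pi * ((2 * k + 1 : ℕ) : ℝ) * x))
      (Real.pi ^ 2 * (1 / 8 - x / 2)) := by
    intro x hx
    let f : ℕ → ℝ := fun n => 1 / (n : ℝ) ^ 2 * Real.cos (2 * Real.pi * n * x)
    have h1 : HasSum f _ := hS x ⟨hx.1, by linarith [hx.2]⟩
    have h2 := (hS (2 * x) ⟨by linarith [hx.1], by linarith [hx.2]⟩).mul_left (1 / 4)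
    have h3 : HasSum (fun k : ℕ => f (2 * k))
        (1 / 4 * (Real.pi ^ 2 * ((2 * x) ^ 2 - 2 * x + 6⁻¹))) := by
      have e : (fun k : ℕ => f (2 * k)) = fun n : ℕ =>
          1 / 4 * (1 / (n : ℝ) ^ 2 * Real.cos (2 * Real.pi * n * (2 * x))) := by
        funext k
        have e2 : 2 * Real.pi * ((2 * k : ℕ) : ℝ) * x = 2 * Real.pi * k * (2 * x) := by
          push_cast
          ring
        simp only [f, e2]
        push_cast
        ring
      rw [e]
      exact h2
    have hinj : Function.Injective fun k : ℕ => 2 * k + 1 := fun a b h => by simpa using h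
    have h4 : HasSum (fun k : ℕ => f (2 * k + 1)) (∑' k : ℕ, f (2 * k + 1)) :=
      (h1.summable.comp_injective hinj).hasSum
    have h5 := (HasSum.even_add_odd h3 h4).unique h1
    have h6 : ∑' k : ℕ, f (2 * k + 1) = Real.pi ^ 2 * (1 / 8 - x / 2) := by
      linear_combination h5
    rw [h6] at h4
    exact h4
  have hx : t / (2 * T) ∈ Set.Icc (0 : ℝ) (1 / 2) := by
    refine ⟨by have := ht.1; positivity, ?_⟩
    rw [div_le_div_iff₀ (by positivity) (by norm_num)]
    linarith [ht.2]
  -- By `2 sin² = 1 - cos`, the required series is a multiple of the difference of the odd series at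
  -- `0` and at `t / (2T)`: indeed `2 ω_k t = 2π(2k+1) · t/(2T)`.
  have h := ((hodd 0 ⟨le_rfl, by norm_num⟩).sub (hodd _ hx)).mul_left (4 * T / Real.pi ^ 2)
  have hpi := Real.pi_pos.ne'
  have e1 : t = 4 * T / Real.pi ^ 2 *
      (Real.pi ^ 2 * (1 / 8 - 0 / 2) - Real.pi ^ 2 * (1 / 8 - t / (2 * T) / 2)) := by
    have := hT.ne'
    field_simp
    ring
  rw [← e1] at h
  refine h.congr_fun fun k => ?_
  have h1 : Real.cos (2 * Real.pi * ((2 * k + 1 : ℕ) : ℝ) * (t / (2 * T)))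
      = 1 - 2 * Real.sin (freq T k * t) ^ 2 := by
    rw [show 2 * Real.pi * ((2 * k + 1 : ℕ) : ℝ) * (t / (2 * T)) = 2 * (freq T k * t) by
      unfold freq; push_cast; field_simp, Real.cos_two_mul]
    linear_combination (2 : ℝ) * Real.sin_sq_add_cos_sq (freq T k * t)
  rw [h1, sineFun, div_pow, mul_pow, Real.sq_sqrt (by positivity)]
  simp only [mul_zero, Real.cos_zero]
  unfold freq
  push_cast
  have : (2 * (k : ℝ) + 1) ≠ 0 := by positivity
  have : ((k : ℝ) + 1 / 2) ≠ 0 := by positivity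
  field_simp
  ring

variable {F : Type*} [NormedAddCommGroup F] [InnerProductSpace ℂ F] [CompleteSpace F]

/-- A continuous curve with the covariance function of the Wiener process. -/
structure IsWienerCurve (b : ℝ → F) : Prop where
  continuous : Continuous b
  inner_eq : ∀ s t, 0 ≤ s → 0 ≤ t → ⟪b s, b t⟫_ℂ = (min s t : ℝ)

/-- The Karhunen-Loeve vectors of a curve. -/
def klVec (b : ℝ → F) (T : ℝ) (k : ℕ) : F :=
  freq T k • ∫ t in (0 : ℝ)..T, sineFun T k t • b t

theorem klVec_map {b : ℝ → F} (hb : Continuous b) {G : Type*} [NormedAddCommGroup G]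
    [NormedSpace ℝ G] [CompleteSpace G] (L : F →L[ℝ] G) (T : ℝ) (k : ℕ) :
    L (klVec b T k) = freq T k • ∫ t in (0 : ℝ)..T, sineFun T k t • L (b t) := by
  have hc : Continuous fun t => sineFun T k t • b t := (continuous_sineFun T k).smul hb
  rw [klVec, map_smul, ← L.intervalIntegral_comp_comm (hc.intervalIntegrable _ _)]
  simp only [map_smul]

theorem inner_klVec {b : ℝ → F} (hb : Continuous b) (q : F) (T : ℝ) (k : ℕ) :
    ⟪q, klVec b T k⟫_ℂ = freq T k • ∫ t in (0 : ℝ)..T, sineFun T k t • ⟪q, b t⟫_ℂ :=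
  klVec_map hb ((innerSL ℂ q).restrictScalars ℝ) T k

namespace IsWienerCurve

variable {b : ℝ → F} {T : ℝ}

theorem inner_klVec_right (hb : IsWienerCurve b) (hT : 0 < T) (k : ℕ) {t : ℝ}
    (ht : t ∈ Set.Icc 0 T) : ⟪b t, klVec b T k⟫_ℂ = (sineFun T k t / freq T k : ℝ) := by
  have hω := (freq_pos hT k).ne'
  rw [inner_klVec hb.continuous]
  have h : ∫ s in (0 : ℝ)..T, sineFun T k s • ⟪b t, b s⟫_ℂ
      = ∫ s in (0 : ℝ)..T, ((sineFun T k s * min s t : ℝ) : ℂ) := by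
    refine intervalIntegral.integral_congr fun s hs => ?_
    rw [Set.uIcc_of_le hT.le] at hs
    simp only [hb.inner_eq t s ht.1 hs.1, min_comm t s, Complex.real_smul]
    push_cast
    ring
  rw [h, intervalIntegral.integral_ofReal, integral_sineFun_mul_min hT k ht, Complex.real_smul,
    ← Complex.ofReal_mul]
  congr 1
  field_simp

/-- The formula is deliberately asymmetric in `k` and `l`: compared with its conjugate it yields
orthogonality. -/
theorem inner_klVec_klVec (hb : IsWienerCurve b) (hT : 0 < T) (k l : ℕ) :
    ⟪klVec b T l, klVec b T k⟫_ℂ =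
      (freq T l / freq T k * ∫ s in (0 : ℝ)..T, sineFun T l s * sineFun T k s : ℝ) := by
  rw [← inner_conj_symm, inner_klVec hb.continuous]
  have h : ∫ s in (0 : ℝ)..T, sineFun T l s • ⟪klVec b T k, b s⟫_ℂ
      = ∫ s in (0 : ℝ)..T, (((freq T k)⁻¹ * (sineFun T l s * sineFun T k s) : ℝ) : ℂ) := by
    refine intervalIntegral.integral_congr fun s hs => ?_
    rw [Set.uIcc_of_le hT.le] at hs
    simp only [← inner_conj_symm (klVec b T k) (b s), hb.inner_klVec_right hT k hs,
      Complex.conj_ofReal, Complex.real_smul, ← Complex.ofReal_mul]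
    congr 1
    ring
  rw [h, intervalIntegral.integral_ofReal, intervalIntegral.integral_const_mul, Complex.real_smul,
    ← Complex.ofReal_mul, Complex.conj_ofReal]
  congr 1
  ring

/-- Hermitian symmetry of the inner product gives `(ω_k² - ω_l²) ∫ f_l f_k = 0`, the usual argument
for distinct eigenvalues, so no integral of a product of distinct sines has to be evaluated. -/
theorem orthonormal_klVec (hb : IsWienerCurve b) (hT : 0 < T) : Orthonormal ℂ (klVec b T) := by
  rw [orthonormal_iff_ite]
  intro l k
  rcases eq_or_ne l k with rfl | hne
  · rw [hb.inner_klVec_klVec hT, integral_sineFun_sq hT, div_self (freq_pos hT l).ne']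
    simp
  · rw [if_neg hne, hb.inner_klVec_klVec hT]
    have h1 := hb.inner_klVec_klVec hT k l
    have h2 := hb.inner_klVec_klVec hT l k
    rw [← inner_conj_symm, h2, Complex.conj_ofReal, Complex.ofReal_inj] at h1
    have h3 : ∫ s in (0 : ℝ)..T, sineFun T k s * sineFun T l s
        = ∫ s in (0 : ℝ)..T, sineFun T l s * sineFun T k s := by
      simp only [mul_comm]
    rw [h3] at h1
    set c := ∫ s in (0 : ℝ)..T, sineFun T l s * sineFun T k s
    have hk := freq_pos hT k
    have hl := freq_pos hT l
    have h4 : (freq T k ^ 2 - freq T l ^ 2) * c = 0 := by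
      field_simp at h1
      linear_combination h1
    have h5 : freq T k ^ 2 - freq T l ^ 2 ≠ 0 := by
      intro h0
      have h6 : freq T k = freq T l :=
        (sq_eq_sq₀ hk.le hl.le).1 (sub_eq_zero.1 h0)
      unfold freq at h6
      have h7 := mul_left_cancel₀ (div_pos Real.pi_pos hT).ne' h6
      exact hne (by exact_mod_cast (add_right_cancel h7).symm)
    rw [(mul_eq_zero.1 h4).resolve_left h5, mul_zero, Complex.ofReal_zero]

end IsWienerCurve

omit [CompleteSpace F] in
theorem Orthonormal.norm_sum_real_smul_sq {ι : Type*} {e : ι → F} (he : Orthonormal ℂ e) (c : ι → ℝ)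
    (s : Finset ι) : ‖∑ k ∈ s, c k • e k‖ ^ 2 = ∑ k ∈ s, c k ^ 2 := by
  have h := he.inner_sum (fun k => (c k : ℂ)) (fun k => (c k : ℂ)) s
  have h2 : ∑ k ∈ s, c k • e k = ∑ k ∈ s, (c k : ℂ) • e k := rfl
  rw [h2, ← inner_self_eq_norm_sq (𝕜 := ℂ), h]
  simp [sq, ← Complex.ofReal_mul]

theorem Orthonormal.summable_real_smul {ι : Type*} {e : ι → F} (he : Orthonormal ℂ e) {c : ι → ℝ}
    (hc : Summable fun k => c k ^ 2) : Summable fun k => c k • e k := by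
  have h := (he.orthogonalFamily.summable_iff_norm_sq_summable (fun k => (c k : ℂ))).2
    (by simpa using hc)
  exact h

/-- The Karhunen-Loeve expansion. -/
theorem IsWienerCurve.hasSum_klVec {b : ℝ → F} (hb : IsWienerCurve b) {T : ℝ} (hT : 0 < T) {t : ℝ}
    (ht : t ∈ Set.Icc 0 T) :
    HasSum (fun k => (sineFun T k t / freq T k) • klVec b T k) (b t) := by
  have he := hb.orthonormal_klVec hT
  set c : ℕ → ℝ := fun k => sineFun T k t / freq T k with hc
  -- The squared error of a partial sum is the defect in Bessel's inequality for `‖b t‖² = t`, which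
  -- the Mercer identity sends to zero.
  have hnorm : ∀ s : Finset ℕ, ‖∑ k ∈ s, c k • klVec b T k - b t‖ ^ 2 = t - ∑ k ∈ s, c k ^ 2 := by
    intro s
    have h1 : ⟪b t, ∑ k ∈ s, c k • klVec b T k⟫_ℂ = ((∑ k ∈ s, c k ^ 2 : ℝ) : ℂ) := by
      rw [inner_sum]
      push_cast
      refine Finset.sum_congr rfl fun k _ => ?_
      rw [RCLike.real_smul_eq_coe_smul (K := ℂ), inner_smul_right, hb.inner_klVec_right hT k ht, sq]
      rfl
    have h2 : ‖b t‖ ^ 2 = t := by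
      rw [← inner_self_eq_norm_sq (𝕜 := ℂ), hb.inner_eq t t ht.1 ht.1]
      simp
    rw [norm_sub_rev, @norm_sub_sq ℂ, h1, h2, he.norm_sum_real_smul_sq]
    change t - 2 * (((∑ k ∈ s, c k ^ 2 : ℝ) : ℂ)).re + _ = _
    rw [Complex.ofReal_re]
    ring
  have hsum : HasSum (fun k => c k ^ 2) t := hasSum_sineFun_div_freq_sq hT ht
  rw [HasSum, tendsto_iff_norm_sub_tendsto_zero]
  have h1 : Filter.Tendsto (fun s : Finset ℕ => t - ∑ k ∈ s, c k ^ 2) Filter.atTop (nhds 0) := by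
    have h2 : Filter.Tendsto (fun s : Finset ℕ => ∑ k ∈ s, c k ^ 2) Filter.atTop (nhds t) := hsum
    simpa using h2.const_sub t
  have h3 := h1.sqrt
  rw [Real.sqrt_zero] at h3
  refine h3.congr fun s => ?_
  rw [← hnorm, Real.sqrt_sq (norm_nonneg _)]

/-- The sine expansion of a twice differentiable function which vanishes at zero, obtained from the
Karhunen-Loeve expansion of a Wiener curve. -/
theorem IsWienerCurve.hasSum_sineFun {b : ℝ → F} (hb : IsWienerCurve b) {T : ℝ} (hT : 0 < T)
    {g g' g'' : ℝ → ℝ} (h1 : ∀ t, HasDerivAt g (g' t) t) (h2 : ∀ t, HasDerivAt g' (g'' t) t)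
    (hc : Continuous g'') (h0 : g 0 = 0) {t : ℝ} (ht : t ∈ Set.Icc 0 T) :
    HasSum (fun k => sineFun T k t * ∫ s in (0 : ℝ)..T, sineFun T k s * g s) (g t) := by
  -- A vector representing `g` through `⟪b t, q⟫ = g t`: `min` is the Green function of `-d²/dt²`,
  -- and `g' T • b T` supplies the boundary term. Pairing the expansion of `b t` with `q` gives the
  -- sine series of `g`.
  let q : F := g' T • b T - ∫ s in (0 : ℝ)..T, g'' s • b s
  have hq : ∀ t ∈ Set.Icc 0 T, ⟪b t, q⟫_ℂ = (g t : ℂ) := by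
    intro t ht
    have hi : ⟪b t, ∫ s in (0 : ℝ)..T, g'' s • b s⟫_ℂ
        = ((∫ s in (0 : ℝ)..T, g'' s * min s t : ℝ) : ℂ) := by
      have hcb : Continuous fun s => g'' s • b s := hc.smul hb.continuous
      have := ((innerSL ℂ (b t)).restrictScalars ℝ).intervalIntegral_comp_comm
        (hcb.intervalIntegrable (μ := MeasureTheory.volume) 0 T)
      refine this.symm.trans ?_
      rw [← intervalIntegral.integral_ofReal]
      refine intervalIntegral.integral_congr fun s hs => ?_
      rw [Set.uIcc_of_le hT.le] at hs
      simp only [map_smul, ContinuousLinearMap.coe_restrictScalars', innerSL_apply_apply,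
        hb.inner_eq t s ht.1 hs.1, min_comm t s, Complex.real_smul]
      push_cast
      ring
    rw [inner_sub_right, hi, RCLike.real_smul_eq_coe_smul (K := ℂ), inner_smul_right,
      hb.inner_eq t T ht.1 hT.le, min_eq_left ht.2, integral_mul_min h1 h2 hc ht.1 ht.2, h0]
    change (g' T : ℂ) * _ - _ = _
    push_cast
    ring
  have hs := (hb.hasSum_klVec hT ht).mapL ((innerSL ℂ q).restrictScalars ℝ)
  have hs' := Complex.hasSum_re hs
  convert hs' using 1
  · funext k
    simp only [map_smul, ContinuousLinearMap.coe_restrictScalars', innerSL_apply_apply]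
    rw [inner_klVec hb.continuous]
    have h3 : ∫ s in (0 : ℝ)..T, sineFun T k s • ⟪q, b s⟫_ℂ
        = ((∫ s in (0 : ℝ)..T, sineFun T k s * g s : ℝ) : ℂ) := by
      rw [← intervalIntegral.integral_ofReal]
      refine intervalIntegral.integral_congr fun s hs => ?_
      rw [Set.uIcc_of_le hT.le] at hs
      simp only [← inner_conj_symm q (b s), hq s hs, Complex.conj_ofReal, Complex.real_smul,
        Complex.ofReal_mul]
    rw [h3]
    simp only [Complex.real_smul, ← Complex.ofReal_mul, Complex.ofReal_re]
    have := (freq_pos hT k).ne'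
    field_simp
  · change g t = (⟪q, b t⟫_ℂ).re
    rw [← inner_conj_symm, hq t ht]
    simp

end KarhunenLoeve

/-! ### Resolvent-type matrices `℧_k`, their decay, and sine coefficients of the matrix exponential.
-/

section MatrixCoefficients

variable {n : ℕ} {A : Matrix (Fin n) (Fin n) ℝ}

/-- Over `ℂ` one has `ω² + A² = (iω - A)(-iω - A)`, and a Hurwitz matrix has no spectrum on the
imaginary axis. Invertibility returns to `ℝ` through the determinant. -/
theorem isUnit_mhoInv (hA : IsHurwitz A) (T : ℝ) (k : ℕ) : IsUnit (mhoInv A T k) := by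
  set ω := freq T k
  let Ac : Matrix (Fin n) (Fin n) ℂ := A.map Complex.ofReal
  have hunit : ∀ z : ℂ, z.re = 0 → IsUnit (algebraMap ℂ (Matrix (Fin n) (Fin n) ℂ) z - Ac) := by
    intro z hz
    by_contra h
    have h1 := hA z h
    rw [hz] at h1
    exact lt_irrefl _ h1
  have h1 := (hunit (ω * Complex.I) (by simp)).mul (hunit (-(ω * Complex.I)) (by simp))
  have h2 : (algebraMap ℂ (Matrix (Fin n) (Fin n) ℂ) (ω * Complex.I) - Ac)
      * (algebraMap ℂ (Matrix (Fin n) (Fin n) ℂ) (-(ω * Complex.I)) - Ac)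
      = (mhoInv A T k).map Complex.ofReal := by
    have h3 : (mhoInv A T k).map Complex.ofReal
        = algebraMap ℂ (Matrix (Fin n) (Fin n) ℂ) ((ω : ℂ) ^ 2) + Ac * Ac := by
      change Complex.ofRealHom.mapMatrix (mhoInv A T k) = _
      rw [mhoInv, sq A, map_add, map_mul]
      congr 1
      ext i j
      simp only [Matrix.algebraMap_matrix_apply, RingHom.mapMatrix_apply, Matrix.map_apply,
        Matrix.smul_apply, Matrix.one_apply, ω]
      split_ifs <;> simp
    rw [h3, sub_mul, mul_sub, mul_sub, ← map_mul, map_neg, Algebra.commutes (ω * Complex.I) Ac]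
    have h4 : (ω : ℂ) * Complex.I * -(ω * Complex.I) = (ω : ℂ) ^ 2 := by
      linear_combination (-(ω : ℂ) ^ 2) * Complex.I_sq
    rw [h4]
    noncomm_ring
  rw [h2, Matrix.isUnit_iff_isUnit_det] at h1
  have h5 : ((mhoInv A T k).map Complex.ofReal).det = ((mhoInv A T k).det : ℂ) :=
    (Complex.ofRealHom.map_det (mhoInv A T k)).symm
  rw [h5, isUnit_iff_ne_zero, Complex.ofReal_ne_zero, ← isUnit_iff_ne_zero,
    ← Matrix.isUnit_iff_isUnit_det] at h1
  exact h1

theorem mhoInv_mul_mho (hA : IsHurwitz A) (T : ℝ) (k : ℕ) : mhoInv A T k * mho A T k = 1 :=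
  Matrix.mul_nonsing_inv _ ((Matrix.isUnit_iff_isUnit_det _).1 (isUnit_mhoInv hA T k))

theorem mho_mul_mhoInv (hA : IsHurwitz A) (T : ℝ) (k : ℕ) : mho A T k * mhoInv A T k = 1 :=
  Matrix.nonsing_inv_mul _ ((Matrix.isUnit_iff_isUnit_det _).1 (isUnit_mhoInv hA T k))

theorem freq_sq_smul_mho (hA : IsHurwitz A) (T : ℝ) (k : ℕ) :
    freq T k ^ 2 • mho A T k = 1 - A * (A * mho A T k) := by
  have h := mhoInv_mul_mho hA T k
  rw [mhoInv, add_mul, Matrix.smul_mul, one_mul, sq A, mul_assoc] at h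
  exact eq_sub_of_add_eq h

theorem commute_mho (hA : IsHurwitz A) (T : ℝ) (k : ℕ) : A * mho A T k = mho A T k * A := by
  have h1 : A * mhoInv A T k = mhoInv A T k * A := by
    simp only [mhoInv, mul_add, add_mul, sq, Matrix.mul_smul, Matrix.smul_mul, mul_one, one_mul,
      mul_assoc]
  calc A * mho A T k = mho A T k * mhoInv A T k * (A * mho A T k) := by
        rw [mho_mul_mhoInv hA, one_mul]
    _ = mho A T k * (A * mhoInv A T k) * mho A T k := by rw [h1]; simp only [mul_assoc]
    _ = mho A T k * A := by rw [mul_assoc, mul_assoc, mhoInv_mul_mho hA, mul_one]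

section Norm

attribute [local instance] Matrix.linftyOpNormedAddCommGroup Matrix.linftyOpNormedSpace
  Matrix.linftyOpNormedRing Matrix.linftyOpNormedAlgebra

theorem abs_entry_le_linftyOpNorm {ι κ : Type*} [Fintype ι] [Fintype κ] (K : Matrix ι κ ℝ) (i : ι)
    (j : κ) : |K i j| ≤ ‖K‖ := by
  rw [Matrix.linfty_opNorm_def, ← Real.norm_eq_abs, ← coe_nnnorm, NNReal.coe_le_coe]
  exact (Finset.single_le_sum (f := fun j => ‖K i j‖₊) (fun _ _ => zero_le) (Finset.mem_univ j)).trans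
    (Finset.le_sup (f := fun i => ∑ j, ‖K i j‖₊) (Finset.mem_univ i))

/-- From `ω_k² ℧_k = 1 - A² ℧_k` one gets `ω_k² ‖℧_k‖ ≤ ‖1‖ + ‖A‖² ‖℧_k‖`. For large `k` the last
term is at most half of the left side. -/
theorem exists_norm_mho_le (hA : IsHurwitz A) {T : ℝ} (hT : 0 < T) :
    ∃ C : ℝ, 0 ≤ C ∧ ∀ k, freq T k ^ 2 * ‖mho A T k‖ ≤ C := by
  have hlim : Filter.Tendsto (fun k => freq T k) Filter.atTop Filter.atTop := by
    unfold freq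
    refine Filter.Tendsto.const_mul_atTop (div_pos Real.pi_pos hT) ?_
    exact Filter.tendsto_atTop_add_const_right _ _ tendsto_natCast_atTop_atTop
  have h1 : ∀ k, freq T k ^ 2 * ‖mho A T k‖ ≤ ‖(1 : Matrix (Fin n) (Fin n) ℝ)‖
      + ‖A‖ * (‖A‖ * ‖mho A T k‖) := by
    intro k
    calc freq T k ^ 2 * ‖mho A T k‖ = ‖freq T k ^ 2 • mho A T k‖ := by
          rw [norm_smul, Real.norm_of_nonneg (sq_nonneg _)]
      _ = ‖1 - A * (A * mho A T k)‖ := by rw [freq_sq_smul_mho hA]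
      _ ≤ _ := (norm_sub_le _ _).trans (add_le_add le_rfl ((norm_mul_le _ _).trans
          (mul_le_mul_of_nonneg_left (norm_mul_le _ _) (norm_nonneg _))))
  have h2 : ∀ᶠ k in Filter.atTop, freq T k ^ 2 * ‖mho A T k‖
      ≤ 2 * ‖(1 : Matrix (Fin n) (Fin n) ℝ)‖ := by
    filter_upwards [hlim.eventually_ge_atTop (2 * ‖A‖ + 1)] with k hk
    have h3 : 2 * (‖A‖ * ‖A‖) ≤ freq T k ^ 2 := by nlinarith [norm_nonneg A]
    nlinarith [h1 k, norm_nonneg (mho A T k), mul_le_mul_of_nonneg_right h3 (norm_nonneg (mho A T k))]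
  obtain ⟨N, hN⟩ := Filter.eventually_atTop.1 h2
  -- The sum accounts for the finitely many `k` at which absorption may fail.
  refine ⟨2 * ‖(1 : Matrix (Fin n) (Fin n) ℝ)‖ + ∑ k ∈ Finset.range N, freq T k ^ 2 * ‖mho A T k‖,
    by positivity, fun k => ?_⟩
  have h0 : 0 ≤ ∑ k ∈ Finset.range N, freq T k ^ 2 * ‖mho A T k‖ := by positivity
  rcases lt_or_ge k N with hk | hk
  · have h4 : freq T k ^ 2 * ‖mho A T k‖ ≤ ∑ k ∈ Finset.range N, freq T k ^ 2 * ‖mho A T k‖ :=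
      Finset.single_le_sum (f := fun k => freq T k ^ 2 * ‖mho A T k‖)
      (fun k _ => by positivity) (Finset.mem_range.2 hk)
    have := norm_nonneg (1 : Matrix (Fin n) (Fin n) ℝ)
    linarith
  · linarith [hN k hk]

/-- The coefficients of the forced part of the expansion are square summable. -/
theorem summable_sq_coeff (hA : IsHurwitz A) {T : ℝ} (hT : 0 < T) {κ : Type*} [Fintype κ]
    (B : Matrix (Fin n) κ ℝ) (i : Fin n) (j : κ) :
    Summable fun k => (|(freq T k • (mho A T k * B)) i j| + |(A * mho A T k * B) i j|) ^ 2 := by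
  obtain ⟨C, hC0, hC⟩ := exists_norm_mho_le hA hT
  -- This is the lowest frequency; `k + 1/2 ≥ (k + 1)/2` gives `ω_k ≥ ω₀ (k + 1)`, so both
  -- coefficients are `O(1/(k + 1))`.
  set ω₀ := Real.pi / (2 * T) with hω₀
  have hω₀pos : 0 < ω₀ := by have := Real.pi_pos; positivity
  have hω : ∀ k, ω₀ * (k + 1) ≤ freq T k := by
    intro k
    unfold freq
    have h : ω₀ * (k + 1) = Real.pi / T * ((k + 1) / 2) := by rw [hω₀]; field_simp
    rw [h]
    refine mul_le_mul_of_nonneg_left ?_ (div_pos Real.pi_pos hT).le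
    have : (0 : ℝ) ≤ k := k.cast_nonneg
    linarith
  have hbound : ∀ k, |(freq T k • (mho A T k * B)) i j| + |(A * mho A T k * B) i j|
      ≤ (C * ‖B‖ / ω₀ + ‖A‖ * C * ‖B‖ / ω₀ ^ 2) * (1 / ((k : ℝ) + 1)) := by
    intro k
    have hf := freq_pos hT k
    have hk1 : (1 : ℝ) ≤ (k : ℝ) + 1 := by have : (0 : ℝ) ≤ k := k.cast_nonneg; linarith
    have hm : ‖mho A T k‖ ≤ C / freq T k ^ 2 := by
      rw [le_div_iff₀ (by positivity), mul_comm]; exact hC k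
    have e1 : |(freq T k • (mho A T k * B)) i j| ≤ C * ‖B‖ / ω₀ * (1 / ((k : ℝ) + 1)) := by
      calc _ ≤ ‖freq T k • (mho A T k * B)‖ := abs_entry_le_linftyOpNorm _ i j
        _ ≤ freq T k * (C / freq T k ^ 2 * ‖B‖) := by
          rw [norm_smul, Real.norm_of_nonneg hf.le]
          exact mul_le_mul_of_nonneg_left ((Matrix.linfty_opNorm_mul _ _).trans
            (mul_le_mul_of_nonneg_right hm (norm_nonneg _))) hf.le
        _ = C * ‖B‖ / freq T k := by field_simp
        _ ≤ C * ‖B‖ / (ω₀ * (k + 1)) :=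
          div_le_div_of_nonneg_left (by positivity) (by positivity) (hω k)
        _ = _ := by field_simp
    have e2 : |(A * mho A T k * B) i j| ≤ ‖A‖ * C * ‖B‖ / ω₀ ^ 2 * (1 / ((k : ℝ) + 1)) := by
      calc _ ≤ ‖A * mho A T k * B‖ := abs_entry_le_linftyOpNorm _ i j
        _ ≤ ‖A‖ * (C / freq T k ^ 2) * ‖B‖ := (Matrix.linfty_opNorm_mul _ _).trans
            (mul_le_mul_of_nonneg_right ((Matrix.linfty_opNorm_mul _ _).trans
            (mul_le_mul_of_nonneg_left hm (norm_nonneg _))) (norm_nonneg _))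
        _ = ‖A‖ * C * ‖B‖ / freq T k ^ 2 := by ring
        _ ≤ ‖A‖ * C * ‖B‖ / (ω₀ ^ 2 * (k + 1)) := by
          refine div_le_div_of_nonneg_left (by positivity) (by positivity) ?_
          calc ω₀ ^ 2 * (k + 1) ≤ ω₀ ^ 2 * (k + 1) * (k + 1) :=
                le_mul_of_one_le_right (by positivity) hk1
            _ = (ω₀ * (k + 1)) ^ 2 := by ring
            _ ≤ _ := pow_le_pow_left₀ (by positivity) (hω k) 2
        _ = _ := by field_simp
    rw [add_mul]
    exact add_le_add e1 e2
  have hsum : Summable fun k : ℕ => ((C * ‖B‖ / ω₀ + ‖A‖ * C * ‖B‖ / ω₀ ^ 2) *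
      (1 / ((k : ℝ) + 1))) ^ 2 := by
    simp only [mul_pow]
    refine Summable.mul_left _ ?_
    have h := (summable_nat_add_iff 1).2 (Real.summable_one_div_nat_pow.2 one_lt_two)
    refine h.congr fun k => ?_
    push_cast
    rw [div_pow, one_pow]
  exact Summable.of_nonneg_of_le (fun k => sq_nonneg _)
    (fun k => pow_le_pow_left₀ (by positivity) (hbound k) 2) hsum

theorem hasDerivAt_exp_smul_matrix (A : Matrix (Fin n) (Fin n) ℝ) (t : ℝ) :
    HasDerivAt (fun s : ℝ => NormedSpace.exp (s • A)) (A * NormedSpace.exp (t • A)) t :=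
  hasDerivAt_exp_smul_const' A t

theorem HasDerivAt.matrix_entry {G : ℝ → Matrix (Fin n) (Fin n) ℝ} {G' : Matrix (Fin n) (Fin n) ℝ}
    {t : ℝ} (h : HasDerivAt G G' t) (i j : Fin n) : HasDerivAt (fun s => G s i j) (G' i j) t := by
  let L : Matrix (Fin n) (Fin n) ℝ →ₗ[ℝ] ℝ :=
    { toFun := fun K => K i j, map_add' := fun _ _ => rfl, map_smul' := fun _ _ => rfl }
  exact (LinearMap.toContinuousLinearMap L).hasFDerivAt.comp_hasDerivAt t h

/-- The free left factor `K` lets the statement be iterated for higher derivatives, with `K`, `K *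
A`, `K * A * A` in turn. -/
theorem hasDerivAt_mul_exp_entry (K : Matrix (Fin n) (Fin n) ℝ) (i j : Fin n) (t : ℝ) :
    HasDerivAt (fun s : ℝ => (K * NormedSpace.exp (s • A)) i j)
      ((K * A * NormedSpace.exp (t • A)) i j) t := by
  have h := ((hasDerivAt_exp_smul_matrix A t).const_mul K).matrix_entry i j
  rwa [← mul_assoc] at h

theorem integral_sineFun_mul_exp (hA : IsHurwitz A) {T : ℝ} (hT : 0 < T) (k : ℕ) (i j : Fin n) :
    ∫ s in (0 : ℝ)..T, sineFun T k s * (((1 : Matrix (Fin n) (Fin n) ℝ) * NormedSpace.exp (s • A)) i j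
      - (1 : Matrix (Fin n) (Fin n) ℝ) i j) = expCoeff A T k i j := by
  set ω := freq T k with hω
  have hω0 : ω ≠ 0 := (freq_pos hT k).ne'
  -- An explicit antiderivative: differentiating `(f_k A - ω_k g_k) e^{tA}` produces `f_k (ω_k² +
  -- A²) e^{tA}`, and `℧_k` cancels the bracket.
  let G : ℝ → Matrix (Fin n) (Fin n) ℝ := fun t =>
    mho A T k * ((sineFun T k t • A - (ω * cosineFun T k t) • 1) * NormedSpace.exp (t • A))
      + (cosineFun T k t / ω) • 1
  have hG : ∀ t, HasDerivAt G (sineFun T k t • (1 * NormedSpace.exp (t • A) - 1)) t := by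
    intro t
    have h1 := ((hasDerivAt_sineFun T k t).smul_const A).sub
      (((hasDerivAt_cosineFun T k t).const_mul ω).smul_const (1 : Matrix (Fin n) (Fin n) ℝ))
    have h2 := ((h1.mul (hasDerivAt_exp_smul_matrix A t)).const_mul (mho A T k)).add
      (((hasDerivAt_cosineFun T k t).div_const ω).smul_const (1 : Matrix (Fin n) (Fin n) ℝ))
    refine h2.congr_deriv ?_
    have h3 : (freq T k * cosineFun T k t) • A - (ω * -(freq T k * sineFun T k t)) • 1
        = (ω * cosineFun T k t) • A + sineFun T k t • (ω ^ 2 • (1 : Matrix (Fin n) (Fin n) ℝ)) := by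
      rw [smul_smul, sub_eq_add_neg, ← neg_smul]
      congr 2
      ring
    have h4 : (((freq T k * cosineFun T k t) • A - (ω * -(freq T k * sineFun T k t)) • 1)
        * NormedSpace.exp (t • A) +
        (sineFun T k t • A - (ω * cosineFun T k t) • 1) * (A * NormedSpace.exp (t • A)))
        = sineFun T k t • (mhoInv A T k * NormedSpace.exp (t • A)) := by
      rw [h3, mhoInv, ← mul_assoc, ← add_mul, ← Matrix.smul_mul]
      congr 1
      rw [sub_mul, Matrix.smul_mul, Matrix.smul_mul, one_mul, smul_add, sq A]
      abel
    change mho A T k * (((freq T k * cosineFun T k t) • A - (ω * -(freq T k * sineFun T k t)) • 1)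
        * NormedSpace.exp (t • A) +
        (sineFun T k t • A - (ω * cosineFun T k t) • 1) * (A * NormedSpace.exp (t • A)))
        + (-(freq T k * sineFun T k t) / ω) • (1 : Matrix (Fin n) (Fin n) ℝ) = _
    rw [h4, Matrix.mul_smul, ← mul_assoc, mho_mul_mhoInv hA, smul_sub, sub_eq_add_neg, ← neg_smul]
    have h5 : -(freq T k * sineFun T k t) / ω = -sineFun T k t := by
      rw [neg_div, hω, mul_div_cancel_left₀ _ hω0]
    rw [h5]
  have hint := intervalIntegral.integral_eq_sub_of_hasDerivAt (a := 0) (b := T)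
    (fun t _ => (hG t).matrix_entry i j) ?_
  · refine Eq.trans ?_ (hint.trans ?_)
    · rfl
    · have hc : cosineFun T k T = 0 := by simp [cosineFun, cos_freq_mul hT]
      have hs : sineFun T k T = √(2 / T) * (-1) ^ k := by simp [sineFun, sin_freq_mul hT]
      have hc0 : cosineFun T k 0 = √(2 / T) := by simp [cosineFun]
      have hs0 : sineFun T k 0 = 0 := by simp [sineFun]
      rw [← Matrix.sub_apply]
      simp only [G, hc, hs, hc0, hs0, mul_zero, zero_smul, sub_zero, zero_div, add_zero,
        NormedSpace.exp_zero, mul_one, zero_sub]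
      -- Writing `1 = ℧_k (ω_k² + A²)` in the boundary value at `0` cancels the `ω_k ℧_k` term and
      -- leaves the `A²` part of `A_k`.
      have h5 : (√(2 / T) / ω) • (1 : Matrix (Fin n) (Fin n) ℝ)
          = (√(2 / T) / ω) • (mho A T k * mhoInv A T k) := by rw [mho_mul_mhoInv hA]
      rw [h5, expCoeff, mhoInv, commute_mho hA]
      simp only [mul_add, mul_sub, Matrix.mul_smul, Matrix.smul_mul, smul_add, smul_sub, smul_smul,
        mul_neg, mul_one, sq A, mul_assoc, ← hω]
      have h6 : √(2 / T) / ω * ω ^ 2 = ω * √(2 / T) := by field_simp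
      rw [h6, div_eq_mul_inv √(2 / T) ω]
      rw [neg_add_cancel_left]
  · refine Continuous.intervalIntegrable ?_ _ _
    have h7 : Continuous fun t : ℝ => ((1 : Matrix (Fin n) (Fin n) ℝ) * NormedSpace.exp (t • A)) i j :=
      continuous_iff_continuousAt.2 fun t => (hasDerivAt_mul_exp_entry 1 i j t).continuousAt
    exact (continuous_sineFun T k).mul (h7.sub continuous_const)

/-- The general sine expansion applies because `e^{tA} - 1` vanishes at `0`. The curve `b` is only a
tool: neither the series nor its sum depends on it. -/
theorem hasSum_sineFun_mul_expCoeff {F : Type*} [NormedAddCommGroup F] [InnerProductSpace ℂ F]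
    [CompleteSpace F] {b : ℝ → F} (hb : IsWienerCurve b) (hA : IsHurwitz A) {T : ℝ} (hT : 0 < T)
    {t : ℝ} (ht : t ∈ Set.Icc 0 T) (i j : Fin n) :
    HasSum (fun k => sineFun T k t * expCoeff A T k i j)
      ((NormedSpace.exp (t • A)) i j - (1 : Matrix (Fin n) (Fin n) ℝ) i j) := by
  have h := hb.hasSum_sineFun hT (g := fun s => ((1 : Matrix (Fin n) (Fin n) ℝ) * NormedSpace.exp (s • A)) i j
      - (1 : Matrix (Fin n) (Fin n) ℝ) i j)
    (fun s => (hasDerivAt_mul_exp_entry 1 i j s).sub_const _)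
    (fun s => hasDerivAt_mul_exp_entry (1 * A) i j s)
    (continuous_iff_continuousAt.2 fun s =>
      (hasDerivAt_mul_exp_entry (1 * A * A) i j s).continuousAt) (by simp) ht
  simp only [integral_sineFun_mul_exp hA hT] at h
  simpa using h

end Norm

end MatrixCoefficients

/-! ### Uniqueness for the homogeneous integral equation. -/

section LinearEquation

open MeasureTheory

variable {n : ℕ} {κ : Type*} [Fintype κ] {H : Type*} [NormedAddCommGroup H] [NormedSpace ℝ H]
  [CompleteSpace H]

/-- The integral equation `d(t) = ∫_0^t A d(s) ds` has only the zero solution. -/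
theorem eq_zero_of_eq_integral (A : Matrix (Fin n) (Fin n) ℝ) {T : ℝ} (hT : 0 ≤ T)
    {d : ℝ → Fin n → H} (hint : ∀ i, IntervalIntegrable (fun s => d s i) volume 0 T)
    (hd : ∀ t ∈ Set.Icc 0 T, ∀ i, d t i = ∫ s in (0 : ℝ)..t, ∑ l, A i l • d s l) :
    ∀ t ∈ Set.Icc 0 T, ∀ i, d t i = 0 := by
  have hint' : ∀ i, IntervalIntegrable (fun s => ∑ l, A i l • d s l) volume 0 T := fun i => by
    have := IntervalIntegrable.sum Finset.univ fun l _ => (hint l).smul (A i l)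
    refine this.congr fun s _ => ?_
    simp
  have hcont : ∀ i, ContinuousOn (fun t => d t i) (Set.Icc 0 T) := by
    intro i
    have h := intervalIntegral.continuousOn_primitive_interval' (hint' i) Set.left_mem_uIcc
    rw [Set.uIcc_of_le hT] at h
    exact h.congr fun t ht => hd t ht i
  -- `d` is continuous on `[0, T]`, being a primitive there; the extension by constants makes the
  -- integral `D` differentiable everywhere, as convenient for Gronwall's inequality.
  let u : Fin n → ℝ → H := fun i => Set.IccExtend hT ((Set.Icc 0 T).domRestrict fun t => d t i)
  have hu : ∀ i, Continuous (u i) := fun i => (hcont i).domRestrict.Icc_extend'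
  have hud : ∀ i, ∀ t ∈ Set.Icc 0 T, u i t = d t i := fun i t ht =>
    Set.IccExtend_of_mem hT _ ht
  let D : ℝ → Fin n → H := fun t i => ∫ s in (0 : ℝ)..t, ∑ l, A i l • u l s
  have hDderiv : ∀ t, HasDerivAt D (fun i => ∑ l, A i l • u l t) t := by
    intro t
    rw [hasDerivAt_pi]
    intro i
    have hc : Continuous fun s => ∑ l, A i l • u l s := by fun_prop
    exact intervalIntegral.integral_hasDerivAt_right (hc.intervalIntegrable _ _)
      (hc.stronglyMeasurableAtFilter _ _) hc.continuousAt
  have hDd : ∀ t ∈ Set.Icc 0 T, D t = d t := by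
    intro t ht
    funext i
    rw [hd t ht i]
    refine intervalIntegral.integral_congr fun s hs => ?_
    rw [Set.uIcc_of_le ht.1] at hs
    simp only [hud _ s ⟨hs.1, hs.2.trans ht.2⟩]
  have h0 := eq_zero_of_abs_deriv_le_mul_abs_self_of_eq_zero_right (f := D)
    (f' := fun t i => ∑ l, A i l • u l t) (K := ∑ i, ∑ l, |A i l|) (a := 0) (b := T)
    (fun t _ => (hDderiv t).continuousAt.continuousWithinAt)
    (fun t _ => (hDderiv t).hasDerivWithinAt) (by funext i; simp [D]) fun t ht => by
      have ht' : t ∈ Set.Icc 0 T := ⟨ht.1, ht.2.le⟩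
      rw [hDd t ht']
      refine (pi_norm_le_iff_of_nonneg (by positivity)).2 fun i => ?_
      calc ‖∑ l, A i l • u l t‖ ≤ ∑ l, |A i l| * ‖d t‖ := by
            refine (norm_sum_le _ _).trans (Finset.sum_le_sum fun l _ => ?_)
            rw [norm_smul, Real.norm_eq_abs, hud l t ht']
            exact mul_le_mul_of_nonneg_left (norm_le_pi_norm _ _) (abs_nonneg _)
        _ = (∑ l, |A i l|) * ‖d t‖ := by rw [Finset.sum_mul]
        _ ≤ _ := mul_le_mul_of_nonneg_right (Finset.single_le_sum
            (f := fun i => ∑ l, |A i l|) (fun i _ => by positivity) (Finset.mem_univ i))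
            (norm_nonneg _)
  intro t ht i
  rw [← hDd t ht, h0 t ht]
  rfl

end LinearEquation

/-! ### The forced solution as a series of Karhunen-Loeve vectors. -/

section ForcedSolution

open MeasureTheory

variable {n : ℕ} {κ : Type*} [Fintype κ] {F : Type*} [NormedAddCommGroup F]
  [InnerProductSpace ℂ F] [CompleteSpace F]

/-- The vector `∑ⱼ Kᵢⱼ eₖʲ`, where `eₖʲ` are the Karhunen-Loeve vectors of the curves `b j`. -/
def klComb (b : κ → ℝ → F) (T : ℝ) (K : Matrix (Fin n) κ ℝ) (k : ℕ) (i : Fin n) : F :=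
  ∑ j, K i j • klVec (b j) T k

variable {b : κ → ℝ → F} {T : ℝ}

omit [CompleteSpace F] in
theorem klComb_sub (K K' : Matrix (Fin n) κ ℝ) (k : ℕ) (i : Fin n) :
    klComb b T (K - K') k i = klComb b T K k i - klComb b T K' k i := by
  simp [klComb, sub_smul, Finset.sum_sub_distrib]

omit [CompleteSpace F] in
theorem klComb_smul (r : ℝ) (K : Matrix (Fin n) κ ℝ) (k : ℕ) (i : Fin n) :
    klComb b T (r • K) k i = r • klComb b T K k i := by
  simp [klComb, Finset.smul_sum, smul_smul]

omit [CompleteSpace F] in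
theorem klComb_mul (A : Matrix (Fin n) (Fin n) ℝ) (K : Matrix (Fin n) κ ℝ) (k : ℕ) (i : Fin n) :
    klComb b T (A * K) k i = ∑ l, A i l • klComb b T K k l := by
  simp only [klComb, Matrix.mul_apply, Finset.sum_smul, Finset.smul_sum, smul_smul]
  exact Finset.sum_comm

/-- The `k`-th term `f_k(t) ω_k ℧_k B e_k - g_k(t) A ℧_k B e_k` of the forced solution. -/
def forcedTerm (b : κ → ℝ → F) (A : Matrix (Fin n) (Fin n) ℝ) (B : Matrix (Fin n) κ ℝ) (T : ℝ)
    (k : ℕ) (t : ℝ) (i : Fin n) : F :=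
  sineFun T k t • klComb b T (freq T k • (mho A T k * B)) k i
    - cosineFun T k t • klComb b T (A * mho A T k * B) k i

variable {A : Matrix (Fin n) (Fin n) ℝ} {B : Matrix (Fin n) κ ℝ}

omit [CompleteSpace F] in
theorem forcedTerm_eq (k : ℕ) (t : ℝ) (i : Fin n) : forcedTerm b A B T k t i =
    ∑ j, (sineFun T k t * (freq T k • (mho A T k * B)) i j
      - cosineFun T k t * (A * mho A T k * B) i j) • klVec (b j) T k := by
  simp only [forcedTerm, klComb, sub_smul, Finset.sum_sub_distrib, mul_smul, Finset.smul_sum]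

theorem abs_forcedCoeff_le (k : ℕ) (t p q : ℝ) :
    |sineFun T k t * p - cosineFun T k t * q| ≤ √(2 / T) * (|p| + |q|) := by
  have h1 : |sineFun T k t| ≤ √(2 / T) := by
    rw [sineFun, abs_mul, abs_of_nonneg (Real.sqrt_nonneg _)]
    exact mul_le_of_le_one_right (Real.sqrt_nonneg _) (Real.abs_sin_le_one _)
  have h2 : |cosineFun T k t| ≤ √(2 / T) := by
    rw [cosineFun, abs_mul, abs_of_nonneg (Real.sqrt_nonneg _)]
    exact mul_le_of_le_one_right (Real.sqrt_nonneg _) (Real.abs_cos_le_one _)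
  calc _ ≤ |sineFun T k t| * |p| + |cosineFun T k t| * |q| := by
        rw [← abs_mul, ← abs_mul]; exact abs_sub _ _
    _ ≤ √(2 / T) * |p| + √(2 / T) * |q| := add_le_add
        (mul_le_mul_of_nonneg_right h1 (abs_nonneg _)) (mul_le_mul_of_nonneg_right h2 (abs_nonneg _))
    _ = _ := by ring

omit [Fintype κ] in
theorem sq_forcedCoeff_le (k : ℕ) (t : ℝ) (i : Fin n) (j : κ) :
    (sineFun T k t * (freq T k • (mho A T k * B)) i j
      - cosineFun T k t * (A * mho A T k * B) i j) ^ 2 ≤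
    √(2 / T) ^ 2 * (|(freq T k • (mho A T k * B)) i j| + |(A * mho A T k * B) i j|) ^ 2 := by
  rw [← mul_pow, ← sq_abs]
  exact pow_le_pow_left₀ (abs_nonneg _) (abs_forcedCoeff_le k t _ _) 2

theorem summable_forcedTerm (hb : ∀ j, IsWienerCurve (b j)) (hA : IsHurwitz A) (hT : 0 < T) (t : ℝ)
    (i : Fin n) : Summable fun k => forcedTerm b A B T k t i := by
  simp only [forcedTerm_eq]
  refine summable_sum fun j _ => ((hb j).orthonormal_klVec hT).summable_real_smul ?_
  exact Summable.of_nonneg_of_le (fun k => sq_nonneg _) (fun k => sq_forcedCoeff_le k t i j)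
    ((summable_sq_coeff hA hT B i j).mul_left _)

/-- Parseval in each channel gives a bound uniform both in the partial sum and in `t`; this constant
dominates all limits under the integral. -/
theorem exists_norm_sum_forcedTerm_le (hb : ∀ j, IsWienerCurve (b j)) (hA : IsHurwitz A)
    (hT : 0 < T) (i : Fin n) :
    ∃ C : ℝ, ∀ (s : Finset ℕ) (t : ℝ), ‖∑ k ∈ s, forcedTerm b A B T k t i‖ ≤ C := by
  refine ⟨∑ j, √(∑' k, √(2 / T) ^ 2 *
    (|(freq T k • (mho A T k * B)) i j| + |(A * mho A T k * B) i j|) ^ 2), fun s t => ?_⟩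
  simp only [forcedTerm_eq]
  rw [Finset.sum_comm]
  refine (norm_sum_le _ _).trans (Finset.sum_le_sum fun j _ => ?_)
  refine Real.le_sqrt_of_sq_le ?_
  rw [((hb j).orthonormal_klVec hT).norm_sum_real_smul_sq]
  exact (Finset.sum_le_sum fun k _ => sq_forcedCoeff_le k t i j).trans
    (((summable_sq_coeff hA hT B i j).mul_left _).sum_le_tsum s fun k _ => by positivity)

/-- The forced part of the solution of the linear equation. -/
def forcedSol (b : κ → ℝ → F) (A : Matrix (Fin n) (Fin n) ℝ) (B : Matrix (Fin n) κ ℝ) (T t : ℝ)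
    (i : Fin n) : F := ∑' k, forcedTerm b A B T k t i

theorem hasSum_forcedTerm (hb : ∀ j, IsWienerCurve (b j)) (hA : IsHurwitz A) (hT : 0 < T) (t : ℝ)
    (i : Fin n) : HasSum (fun k => forcedTerm b A B T k t i) (forcedSol b A B T t i) :=
  (summable_forcedTerm hb hA hT t i).hasSum

omit [CompleteSpace F] in
-- The subtracted vector is the `k`-th term of `B b(t)`, which is summed separately without being
-- differentiated. What remains is differentiable with the right derivative because `ω_k² ℧_k B - B
-- = -A² ℧_k B`.
theorem hasDerivAt_forcedTerm (hA : IsHurwitz A) (hT : 0 < T) (k : ℕ) (t : ℝ) (i : Fin n) :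
    HasDerivAt (fun t => forcedTerm b A B T k t i - (sineFun T k t / freq T k) • klComb b T B k i)
      (∑ l, A i l • forcedTerm b A B T k t l) t := by
  have hω := (freq_pos hT k).ne'
  have h := (((hasDerivAt_sineFun T k t).smul_const
    (klComb b T (freq T k • (mho A T k * B)) k i)).sub
    ((hasDerivAt_cosineFun T k t).smul_const (klComb b T (A * mho A T k * B) k i))).sub
    (((hasDerivAt_sineFun T k t).div_const (freq T k)).smul_const (klComb b T B k i))
  refine h.congr_deriv ?_
  have h1 : freq T k • (freq T k • (mho A T k * B)) = B - A * (A * mho A T k * B) := by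
    rw [smul_smul, ← sq, ← Matrix.smul_mul, freq_sq_smul_mho hA, Matrix.sub_mul, Matrix.one_mul,
      Matrix.mul_assoc A (A * mho A T k)]
  have h2 : A * (freq T k • (mho A T k * B)) = freq T k • (A * mho A T k * B) := by
    rw [Matrix.mul_smul, Matrix.mul_assoc]
  simp only [forcedTerm, smul_sub, Finset.sum_sub_distrib, smul_comm (A i _) (sineFun T k t),
    smul_comm (A i _) (cosineFun T k t), ← Finset.smul_sum, ← klComb_mul, h2]
  rw [mul_comm (freq T k), mul_smul, ← klComb_smul, h1, klComb_sub, klComb_smul (freq T k)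
    (A * mho A T k * B), mul_div_cancel_right₀ _ hω, smul_sub]
  simp only [smul_smul, neg_smul]
  rw [mul_comm (freq T k)]
  abel

omit [CompleteSpace F] in
theorem continuous_forcedTerm (k : ℕ) (i : Fin n) :
    Continuous fun t => forcedTerm b A B T k t i :=
  ((continuous_sineFun T k).smul continuous_const).sub
    ((continuous_cosineFun T k).smul continuous_const)

theorem intervalIntegrable_forcedSol (hb : ∀ j, IsWienerCurve (b j)) (hA : IsHurwitz A) (hT : 0 < T)
    (i : Fin n) (x y : ℝ) :
    IntervalIntegrable (fun t => forcedSol b A B T t i) volume x y := by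
  obtain ⟨C, hC⟩ := exists_norm_sum_forcedTerm_le (B := B) hb hA hT i
  have hlim : ∀ t, Filter.Tendsto (fun s : Finset ℕ => ∑ k ∈ s, forcedTerm b A B T k t i)
      Filter.atTop (nhds (forcedSol b A B T t i)) := fun t => hasSum_forcedTerm hb hA hT t i
  have hmeas : AEStronglyMeasurable (fun t => forcedSol b A B T t i) volume :=
    aestronglyMeasurable_of_tendsto_ae Filter.atTop
      (f := fun (s : Finset ℕ) t => ∑ k ∈ s, forcedTerm b A B T k t i)
      (fun s => (continuous_finsetSum s fun k _ => continuous_forcedTerm k i).aestronglyMeasurable)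
      (Filter.Eventually.of_forall hlim)
  refine (intervalIntegrable_const (c := C)).mono_fun hmeas.restrict
    (Filter.Eventually.of_forall fun t => ?_)
  exact (le_of_tendsto' (hlim t).norm fun s => hC s t).trans (le_abs_self C)

/-- Each partial sum satisfies the equation with `b` replaced by its truncated expansion. Dominated
convergence handles the integral, and the Karhunen-Loeve expansion, valid on `[0, T]`, handles the
noise. -/
theorem forcedSol_sub_eq (hb : ∀ j, IsWienerCurve (b j)) (hA : IsHurwitz A) (hT : 0 < T) {t : ℝ}
    (ht : t ∈ Set.Icc 0 T) (i : Fin n) :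
    forcedSol b A B T t i - forcedSol b A B T 0 i =
      (∫ s in (0 : ℝ)..t, ∑ l, A i l • forcedSol b A B T s l) + ∑ j, B i j • b j t := by
  choose C hC using exists_norm_sum_forcedTerm_le (B := B) hb hA hT
  have hlim : ∀ t i, Filter.Tendsto (fun s : Finset ℕ => ∑ k ∈ s, forcedTerm b A B T k t i)
      Filter.atTop (nhds (forcedSol b A B T t i)) := fun t i => hasSum_forcedTerm hb hA hT t i
  have hcont : ∀ (s : Finset ℕ) i, Continuous fun t => ∑ k ∈ s, forcedTerm b A B T k t i :=
    fun s i => continuous_finsetSum s fun k _ => continuous_forcedTerm k i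
  have hI : Filter.Tendsto (fun s : Finset ℕ => ∫ r in (0 : ℝ)..t,
      ∑ l, A i l • ∑ k ∈ s, forcedTerm b A B T k r l) Filter.atTop
      (nhds (∫ r in (0 : ℝ)..t, ∑ l, A i l • forcedSol b A B T r l)) := by
    refine intervalIntegral.tendsto_integral_filter_of_dominated_convergence
      (fun _ => ∑ l, |A i l| * C l) (Filter.Eventually.of_forall fun s => ?_)
      (Filter.Eventually.of_forall fun s => Filter.Eventually.of_forall fun r _ => ?_)
      intervalIntegrable_const (Filter.Eventually.of_forall fun r _ => ?_)
    · exact (continuous_finsetSum _ fun l _ => (hcont s l).const_smul _).aestronglyMeasurable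
    · refine (norm_sum_le _ _).trans (Finset.sum_le_sum fun l _ => ?_)
      rw [norm_smul, Real.norm_eq_abs]
      exact mul_le_mul_of_nonneg_left (hC l s r) (abs_nonneg _)
    · exact tendsto_finsetSum _ fun l _ => (hlim r l).const_smul _
  have hB : Filter.Tendsto (fun s : Finset ℕ =>
      ∑ k ∈ s, (sineFun T k t / freq T k) • klComb b T B k i) Filter.atTop
      (nhds (∑ j, B i j • b j t)) := by
    have h : HasSum (fun k => ∑ j, B i j • (sineFun T k t / freq T k) • klVec (b j) T k)
        (∑ j, B i j • b j t) :=
      hasSum_sum fun j _ => ((hb j).hasSum_klVec hT ht).const_smul (B i j)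
    refine (show HasSum _ _ from h.congr_fun fun k => ?_)
    rw [klComb, Finset.smul_sum]
    exact Finset.sum_congr rfl fun j _ => smul_comm _ _ _
  have heq : ∀ s : Finset ℕ, ∑ k ∈ s, forcedTerm b A B T k t i - ∑ k ∈ s, forcedTerm b A B T k 0 i
      = (∫ r in (0 : ℝ)..t, ∑ l, A i l • ∑ k ∈ s, forcedTerm b A B T k r l)
        + ∑ k ∈ s, (sineFun T k t / freq T k) • klComb b T B k i := by
    intro s
    have h1 : ∀ r, HasDerivAt (fun t => ∑ k ∈ s, (forcedTerm b A B T k t i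
        - (sineFun T k t / freq T k) • klComb b T B k i))
        (∑ l, A i l • ∑ k ∈ s, forcedTerm b A B T k r l) r := by
      intro r
      refine (HasDerivAt.fun_sum fun k _ => hasDerivAt_forcedTerm hA hT k r i).congr_deriv ?_
      simp only [Finset.smul_sum]
      exact Finset.sum_comm
    have h2 := intervalIntegral.integral_eq_sub_of_hasDerivAt (a := 0) (b := t) (fun r _ => h1 r)
      ((continuous_finsetSum _ fun l _ => (hcont s l).const_smul _).intervalIntegrable _ _)
    rw [h2]
    simp only [Finset.sum_sub_distrib]
    have h3 : ∀ k, sineFun T k 0 = 0 := fun k => by simp [sineFun]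
    simp only [h3, zero_div, zero_smul, Finset.sum_const_zero]
    abel
  refine tendsto_nhds_unique ((hlim t i).sub (hlim 0 i)) ?_
  simp only [heq]
  exact hI.add hB

variable {H : Type*} [NormedAddCommGroup H] [NormedSpace ℝ H] [CompleteSpace H]

/-- The solution of the linear equation driven by the image of Wiener curves under a bounded
operator. -/
theorem eq_exp_add_forcedSol (hb : ∀ j, IsWienerCurve (b j)) (hA : IsHurwitz A) (hT : 0 < T)
    (L : F →L[ℝ] H) {x₀ η : Fin n → H} (hη : ∀ i, η i = x₀ i - L (forcedSol b A B T 0 i))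
    {x : ℝ → Fin n → H} (hint : ∀ i, IntervalIntegrable (fun s => x s i) volume 0 T)
    (hx : ∀ t ∈ Set.Icc 0 T, ∀ i, x t i = x₀ i + (∫ s in (0 : ℝ)..t, ∑ l, A i l • x s l)
      + ∑ j, B i j • L (b j t)) {t : ℝ} (ht : t ∈ Set.Icc 0 T) (i : Fin n) :
    x t i = ∑ l, NormedSpace.exp (t • A) i l • η l + L (forcedSol b A B T t i) := by
  let p : ℝ → Fin n → H := fun t i => ∑ l, NormedSpace.exp (t • A) i l • η l
  let z : ℝ → Fin n → H := fun t i => L (forcedSol b A B T t i)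
  have hexp : ∀ (K : Matrix (Fin n) (Fin n) ℝ) t i,
      HasDerivAt (fun t => ∑ l, (K * NormedSpace.exp (t • A)) i l • η l)
        (∑ l, (K * A * NormedSpace.exp (t • A)) i l • η l) t := fun K t i =>
    HasDerivAt.fun_sum fun l _ => (hasDerivAt_mul_exp_entry K i l t).smul_const (η l)
  have hpc : ∀ i, Continuous fun t => p t i := fun i =>
    continuous_iff_continuousAt.2 fun t => by simpa [p] using (hexp 1 t i).continuousAt
  have hp : ∀ t i, p t i = η i + ∫ s in (0 : ℝ)..t, ∑ l, A i l • p s l := by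
    intro t i
    have h1 : ∀ s, HasDerivAt (fun s => p s i) (∑ l, A i l • p s l) s := by
      intro s
      have h := hexp 1 s i
      simp only [one_mul] at h
      refine h.congr_deriv ?_
      simp only [p, Matrix.mul_apply, Finset.sum_smul, Finset.smul_sum, smul_smul]
      exact Finset.sum_comm
    rw [intervalIntegral.integral_eq_sub_of_hasDerivAt (fun s _ => h1 s)
      ((continuous_finsetSum _ fun l _ => (hpc l).const_smul _).intervalIntegrable _ _)]
    have h0 : p 0 i = η i := by
      simp [p, Matrix.one_apply, ite_smul]
    rw [h0]
    abel
  have hzint : ∀ i x y, IntervalIntegrable (fun t => z t i) volume x y := by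
    intro i x y
    have h := intervalIntegrable_forcedSol (B := B) hb hA hT i x y
    exact ⟨L.integrable_comp h.1, L.integrable_comp h.2⟩
  have hz : ∀ t ∈ Set.Icc 0 T, ∀ i, z t i = z 0 i + (∫ s in (0 : ℝ)..t, ∑ l, A i l • z s l)
      + ∑ j, B i j • L (b j t) := by
    intro t ht i
    have h := congrArg L (forcedSol_sub_eq (B := B) hb hA hT ht i)
    have hi : IntervalIntegrable (fun s => ∑ l, A i l • forcedSol b A B T s l) volume 0 t := by
      have := IntervalIntegrable.sum Finset.univ fun l _ =>
        (intervalIntegrable_forcedSol (B := B) hb hA hT l 0 t).smul (A i l)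
      refine this.congr fun s _ => ?_
      simp
    rw [map_sub, map_add, ← L.intervalIntegral_comp_comm hi] at h
    simp only [map_sum, map_smul] at h
    rw [add_assoc]
    exact sub_eq_iff_eq_add'.1 h
  -- The difference from the candidate satisfies the homogeneous equation: the noise terms cancel,
  -- and so do the initial values since `η = x₀ - z(0)`.
  let d : ℝ → Fin n → H := fun t i => x t i - (p t i + z t i)
  have hpz : ∀ i, IntervalIntegrable (fun t => p t i + z t i) volume 0 T := fun i =>
    ((hpc i).intervalIntegrable 0 T).add (hzint i 0 T)
  have hd := eq_zero_of_eq_integral A hT.le (d := d) (fun i => (hint i).sub (hpz i)) ?_ t ht i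
  · exact sub_eq_zero.1 hd
  · intro t ht i
    have hsum : ∀ {y : ℝ → Fin n → H}, (∀ i, IntervalIntegrable (fun s => y s i) volume 0 t) →
        IntervalIntegrable (fun s => ∑ l, A i l • y s l) volume 0 t := by
      intro y hy
      have := IntervalIntegrable.sum Finset.univ fun l _ => (hy l).smul (A i l)
      refine this.congr fun s _ => ?_
      simp
    have hxt : ∀ i, IntervalIntegrable (fun s => x s i) volume 0 t := fun i =>
      (hint i).mono_set (by
        rw [Set.uIcc_of_le ht.1, Set.uIcc_of_le hT.le]
        exact Set.Icc_subset_Icc_right ht.2)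
    have e : ∫ s in (0 : ℝ)..t, ∑ l, A i l • d s l = (∫ s in (0 : ℝ)..t, ∑ l, A i l • x s l)
        - ((∫ s in (0 : ℝ)..t, ∑ l, A i l • p s l) + ∫ s in (0 : ℝ)..t, ∑ l, A i l • z s l) := by
      rw [← intervalIntegral.integral_add (hsum fun i => (hpc i).intervalIntegrable 0 t)
        (hsum fun i => hzint i 0 t), ← intervalIntegral.integral_sub (hsum hxt)
        ((hsum fun i => (hpc i).intervalIntegrable 0 t).add (hsum fun i => hzint i 0 t))]
      refine intervalIntegral.integral_congr fun s _ => ?_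
      simp only [d, smul_sub, smul_add, Finset.sum_sub_distrib, Finset.sum_add_distrib]
    rw [e]
    change x t i - (p t i + z t i) = _
    rw [hx t ht i, hp t i, hz t ht i, hη]
    change _ - (x₀ i - z 0 i + _ + _) = _
    abel

end ForcedSolution

/-! ### Transfer from one-particle curves to operators on the domain. -/

section Oscillator

open MeasureTheory

variable {μ n : ℕ}

/-- Both quadratures have amplitude of modulus one (`1` or `i`), so only the overlap of the
intervals counts. Inner products between different channels never enter. -/
theorem isWienerCurve_wienerTest (j : Fin 2 × Fin μ) :
    IsWienerCurve fun t => wienerTest t j := by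
  refine ⟨continuous_wienerTest j, fun s t hs ht => ?_⟩
  rw [wienerTest, wienerTest, L2.inner_indicatorConstLp_indicatorConstLp _ _
    ((Measure.restrict_apply_le _ _).trans_lt measure_Icc_lt_top).ne
    ((Measure.restrict_apply_le _ _).trans_lt measure_Icc_lt_top).ne]
  have h1 : (volume.restrict (Set.Ici (0 : ℝ))).real (Set.Icc 0 s ∩ Set.Icc 0 t) = min s t := by
    rw [Set.Icc_inter_Icc, measureReal_restrict_apply (measurableSet_Icc)]
    have h2 : Set.Icc (0 ⊔ 0 : ℝ) (s ⊓ t) ∩ Set.Ici 0 = Set.Icc 0 (min s t) := by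
      ext x
      simp only [sup_idem, Set.mem_inter_iff, Set.mem_Icc, Set.mem_Ici]
      tauto
    rw [h2, Real.volume_real_Icc_of_le (le_min hs ht), sub_zero]
  have h3 : ∀ c : ℂ, c = 1 ∨ c = Complex.I →
      ⟪EuclideanSpace.single j.2 c, EuclideanSpace.single j.2 c⟫_ℂ = 1 := by
    rintro c (rfl | rfl) <;> simp
  rw [h1, h3 _ (by split_ifs <;> simp)]
  simp

variable {H₀ : Type*} [NormedAddCommGroup H₀] [InnerProductSpace ℂ H₀]
  {X₀ : Fin n → H₀ →ₗ.[ℂ] H₀}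

theorem fieldCLM_smul {E : Type*} [NormedAddCommGroup E] [InnerProductSpace ℂ E]
    (P : Submodule ℂ H₀) (ψ : tensorDomain E P) (r : ℝ) (h : E) :
    fieldCLM P ψ (r • h) = (r : ℂ) • fieldCLM P ψ h :=
  (fieldCLM P ψ).map_smul r h

theorem fieldCLM_forcedTerm {E : Type*} [NormedAddCommGroup E] [InnerProductSpace ℂ E]
    [CompleteSpace E] (P : Submodule ℂ H₀) (ψ : tensorDomain E P) (b : Fin 2 × Fin μ → ℝ → E)
    (A : Matrix (Fin n) (Fin n) ℝ) (B : Matrix (Fin n) (Fin 2 × Fin μ) ℝ) (T : ℝ) (k : ℕ) (t : ℝ)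
    (i : Fin n) :
    fieldCLM P ψ (forcedTerm b A B T k t i)
      = (sineFun T k t : ℂ) • fieldCLM P ψ (klComb b T (freq T k • (mho A T k * B)) k i)
        - (cosineFun T k t : ℂ) • fieldCLM P ψ (klComb b T (A * mho A T k * B) k i) := by
  rw [forcedTerm, map_sub, fieldCLM_smul, fieldCLM_smul]

theorem wiener_apply_sub (t : ℝ) (j : Fin 2 × Fin μ)
    (ψ : tensorDomain (OneParticle μ) (initialDomain X₀)) :
    wiener X₀ t j ψ - ψ = fieldCLM _ ψ (wienerTest t j) := by
  simp [wiener, fieldCLM_apply]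

/-- The bounded map `fieldCLM` commutes with the integral, so the operator coefficient is the field
operator of a Karhunen-Loeve vector. -/
theorem qklCoeff_apply (T : ℝ) (k : ℕ) (j : Fin 2 × Fin μ)
    (ψ : tensorDomain (OneParticle μ) (initialDomain X₀)) :
    qklCoeff X₀ T k j ψ = fieldCLM _ ψ (klVec (fun t => wienerTest t j) T k) := by
  rw [klVec_map (continuous_wienerTest j)]
  change (freq T k : ℂ) • ∫ t in (0 : ℝ)..T, (sineFun T k t : ℂ) • (wiener X₀ t j ψ - ψ) = _
  simp only [wiener_apply_sub]
  rfl

theorem opMulVec_qklCoeff_apply (K : Matrix (Fin n) (Fin 2 × Fin μ) ℝ) (T : ℝ) (k : ℕ) (i : Fin n)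
    (ψ : tensorDomain (OneParticle μ) (initialDomain X₀)) :
    opMulVec K (qklCoeff X₀ T k) i ψ
      = fieldCLM _ ψ (klComb (fun j t => wienerTest t j) T K k i) := by
  simp only [opMulVec, LinearMap.sum_apply, LinearMap.smul_apply, qklCoeff_apply, klComb, map_sum,
    fieldCLM_smul]

/-- An operator on the domain is a real linear combination of the initial variables plus a field
operator. -/
def IsFieldAffine (S : DomainOp μ X₀) : Prop :=
  ∃ (a : Fin n → ℝ) (h : OneParticle μ),
    ∀ ψ, S ψ = ∑ j, (a j : ℂ) • initialOp μ X₀ j ψ + fieldCLM _ ψ h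

namespace IsFieldAffine

theorem isQuantumVariable [CompleteSpace H₀] {Θ : Matrix (Fin n) (Fin n) ℝ} (hΘ : Θᵀ = -Θ)
    (hX₀ : SatisfiesWeylCCR Θ X₀) {S : DomainOp μ X₀} (hS : IsFieldAffine S) :
    IsQuantumVariable S := by
  obtain ⟨a, h, hS⟩ := hS
  exact isQuantumVariable_of_eq hΘ hX₀ a h hS

theorem of_apply {S : DomainOp μ X₀} (h : OneParticle μ) (hS : ∀ ψ, S ψ = fieldCLM _ ψ h) :
    IsFieldAffine S := ⟨0, h, fun ψ => by simp [hS]⟩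

theorem initialOp (j : Fin n) : IsFieldAffine (initialOp μ X₀ j) :=
  ⟨Pi.single j 1, 0, fun ψ => by simp [Pi.single_apply, ite_smul]⟩

theorem add {S S' : DomainOp μ X₀} (hS : IsFieldAffine S) (hS' : IsFieldAffine S') :
    IsFieldAffine (S + S') := by
  obtain ⟨a, h, hS⟩ := hS
  obtain ⟨a', h', hS'⟩ := hS'
  refine ⟨a + a', h + h', fun ψ => ?_⟩
  simp only [LinearMap.add_apply, hS, hS', Pi.add_apply, Complex.ofReal_add, add_smul,
    Finset.sum_add_distrib, map_add]
  abel

theorem smul (r : ℝ) {S : DomainOp μ X₀} (hS : IsFieldAffine S) :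
    IsFieldAffine ((r : ℂ) • S) := by
  obtain ⟨a, h, hS⟩ := hS
  refine ⟨r • a, r • h, fun ψ => ?_⟩
  simp only [LinearMap.smul_apply, hS, Pi.smul_apply, smul_eq_mul, Complex.ofReal_mul, mul_smul,
    smul_add, Finset.smul_sum]
  exact congrArg _ (fieldCLM_smul _ ψ r h).symm

theorem sum {ι : Type*} (s : Finset ι) {S : ι → DomainOp μ X₀} (hS : ∀ j, IsFieldAffine (S j)) :
    IsFieldAffine (∑ j ∈ s, S j) := by
  classical
  induction s using Finset.induction_on with
  | empty => exact of_apply 0 fun ψ => by simp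
  | insert j s hj ih =>
    rw [Finset.sum_insert hj]
    exact (hS j).add ih

theorem opMulVec {ι κ : Type*} [Fintype κ] (K : Matrix ι κ ℝ) {V : κ → DomainOp μ X₀}
    (hV : ∀ j, IsFieldAffine (V j)) (i : ι) : IsFieldAffine (opMulVec K V i) :=
  sum _ fun j => (hV j).smul (K i j)

end IsFieldAffine

end Oscillator

end

/-! ### The expansion of the system variables of the oscillator. -/

set_option maxHeartbeats 1000000 in
theorem theorem2 {n μ : ℕ}
    {H₀ : Type*} [NormedAddCommGroup H₀] [InnerProductSpace ℂ H₀] [CompleteSpace H₀]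
    (Θ R : Matrix (Fin n) (Fin n) ℝ) (M : Matrix (Fin 2 × Fin μ) (Fin n) ℝ)
    (hΘ : Θᵀ = -Θ) (hΘdet : IsUnit Θ) (hR : R.IsSymm)
    (A : Matrix (Fin n) (Fin n) ℝ) (hA : A = driftMatrix Θ R M)
    (B : Matrix (Fin n) (Fin 2 × Fin μ) ℝ) (hB : B = dispersionMatrix Θ M)
    (hHurwitz : IsHurwitz A)
    (X₀ : Fin n → H₀ →ₗ.[ℂ] H₀) (hX₀ : SatisfiesWeylCCR Θ X₀)
    (X : ℝ → Fin n → DomainOp μ X₀) (hX : IsQSDESolution A B X₀ X)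
    (T : ℝ) (hT : 0 < T) :
    (∀ k, IsUnit (mhoInv A T k)) ∧
    ∃ ξ : Fin n → DomainOp μ X₀,
      (∀ i ψ, HasSum
        (fun k => (√(2 / T) : ℂ) • opMulVec (A * mho A T k * B) (qklCoeff X₀ T k) i ψ)
        (ξ i ψ - initialOp μ X₀ i ψ)) ∧
      (∀ i, IsQuantumVariable (ξ i)) ∧
      ∃ α β : ℕ → Fin n → DomainOp μ X₀,
        (∀ k, α k = opMulVec (expCoeff A T k) ξ
          + opMulVec (freq T k • (mho A T k * B)) (qklCoeff X₀ T k)) ∧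
        (∀ k, β k = -opMulVec (A * mho A T k * B) (qklCoeff X₀ T k)) ∧
        (∀ k i, IsQuantumVariable (α k i) ∧ IsQuantumVariable (β k i)) ∧
        ∀ t ∈ Set.Icc 0 T, ∀ i,
          IsQuantumVariable (X t i) ∧
          ∀ ψ, HasSum
            (fun k => (sineFun T k t : ℂ) • α k i ψ + (cosineFun T k t : ℂ) • β k i ψ)
            (X t i ψ - ξ i ψ) := by
  let b : Fin 2 × Fin μ → ℝ → OneParticle μ := fun j t => wienerTest t j
  have hb : ∀ j, IsWienerCurve (b j) := isWienerCurve_wienerTest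
  let L : ∀ ψ : tensorDomain (OneParticle μ) (initialDomain X₀),
    OneParticle μ →L[ℝ] SystemFieldSpace H₀ (OneParticle μ) := fieldCLM _
  let z : ℝ → Fin n → OneParticle μ := forcedSol b A B T
  -- `ξ` is introduced in closed form, with the series already summed in the one-particle space; it
  -- is thus manifestly a combination of initial variables and one field operator.
  let ξ : Fin n → DomainOp μ X₀ := fun i =>
    initialOp μ X₀ i - fieldAmpl _ (fieldOp (z 0 i))
  have hξ : ∀ i ψ, ξ i ψ = initialOp μ X₀ i ψ - L ψ (z 0 i) := fun i ψ => rfl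
  have hξaff : ∀ i, IsFieldAffine (ξ i) := by
    intro i
    have h := (IsFieldAffine.initialOp (μ := μ) (X₀ := X₀) i).add
      (((IsFieldAffine.of_apply (S := fieldAmpl _ (fieldOp (z 0 i))) (z 0 i)
        fun ψ => rfl)).smul (-1))
    convert h using 1
    simp [ξ, sub_eq_add_neg]
  have hwaff : ∀ (K : Matrix (Fin n) (Fin 2 × Fin μ) ℝ) k i,
      IsFieldAffine (opMulVec K (qklCoeff X₀ T k) i) := fun K k i =>
    IsFieldAffine.of_apply _ (opMulVec_qklCoeff_apply K T k i)
  have hsol : ∀ t ∈ Set.Icc 0 T, ∀ i ψ, X t i ψ =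
      ∑ l, (NormedSpace.exp (t • A) i l : ℂ) • ξ l ψ + L ψ (z t i) := by
    intro t ht i ψ
    have hW : ∀ t j, (wiener X₀ t j - wiener X₀ 0 j) ψ = L ψ (b j t) := by
      intro t j
      have h0 : b j 0 = 0 := by
        rw [← inner_self_eq_zero (𝕜 := ℂ), (hb j).inner_eq 0 0 le_rfl le_rfl]
        simp
      have h1 := wiener_apply_sub t j ψ
      have h2 := wiener_apply_sub 0 j ψ
      rw [show wienerTest 0 j = (0 : OneParticle μ) from h0, map_zero, sub_eq_zero] at h2
      rw [LinearMap.sub_apply, h2, h1]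
      rfl
    refine eq_exp_add_forcedSol hb hHurwitz hT (L ψ) (x₀ := fun i => initialOp μ X₀ i ψ)
      (η := fun i => ξ i ψ) (fun i => hξ i ψ) (x := fun t i => X t i ψ)
      (fun i => hX.intervalIntegrable T hT.le i ψ) (fun t ht i => ?_) ht i
    rw [hX.integral_eq t ht.1 i ψ]
    simp only [opMulVec, LinearMap.sum_apply, LinearMap.smul_apply, hW]
    rfl
  have hterm : ∀ ψ k t i, L ψ (forcedTerm b A B T k t i) =
      (sineFun T k t : ℂ) • L ψ (klComb b T (freq T k • (mho A T k * B)) k i)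
        - (cosineFun T k t : ℂ) • L ψ (klComb b T (A * mho A T k * B) k i) :=
    fun ψ k t i => fieldCLM_forcedTerm _ ψ b A B T k t i
  refine ⟨isUnit_mhoInv hHurwitz T, ξ, fun i ψ => ?_,
    fun i => (hξaff i).isQuantumVariable hΘ hX₀,
    fun k => opMulVec (expCoeff A T k) ξ
          + opMulVec (freq T k • (mho A T k * B)) (qklCoeff X₀ T k),
    fun k => -opMulVec (A * mho A T k * B) (qklCoeff X₀ T k), fun _ => rfl, fun _ => rfl,
    fun k i => ⟨?_, ?_⟩, fun t ht i => ⟨?_, fun ψ => ?_⟩⟩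
  -- At `t = 0` the sines vanish and the cosines equal `√(2/T)`, so `-z(0)` is the series defining
  -- `ξ - X₀`.
  · have h := ((hasSum_forcedTerm (B := B) hb hHurwitz hT 0 i).mapL (L ψ)).neg
    rw [hξ, sub_sub_cancel_left]
    refine h.congr_fun fun k => ?_
    rw [opMulVec_qklCoeff_apply, hterm]
    simp only [L, b, sineFun, cosineFun, mul_zero, Real.sin_zero, zero_smul,
      Real.cos_zero, mul_one, zero_sub, neg_neg, Complex.ofReal_zero]
    rfl
  · exact ((IsFieldAffine.opMulVec _ hξaff i).add (hwaff _ k i)).isQuantumVariable hΘ hX₀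
  · have h := (hwaff (A * mho A T k * B) k i).smul (-1)
    have h2 : (-opMulVec (A * mho A T k * B) (qklCoeff X₀ T k)) i
        = ((-1 : ℝ) : ℂ) • opMulVec (A * mho A T k * B) (qklCoeff X₀ T k) i := by
      simp
    change IsQuantumVariable ((-opMulVec (A * mho A T k * B) (qklCoeff X₀ T k)) i)
    rw [h2]
    exact h.isQuantumVariable hΘ hX₀
  · have h := (IsFieldAffine.opMulVec (NormedSpace.exp (t • A)) hξaff i).add
      (IsFieldAffine.of_apply (S := fieldAmpl _ (fieldOp (z t i))) (z t i) fun ψ => rfl)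
    have h2 : X t i = opMulVec (NormedSpace.exp (t • A)) ξ i + fieldAmpl _ (fieldOp (z t i)) := by
      refine LinearMap.ext fun ψ => ?_
      rw [hsol t ht i ψ, LinearMap.add_apply]
      simp only [opMulVec, LinearMap.sum_apply, LinearMap.smul_apply]
      rfl
    rw [h2]
    exact h.isQuantumVariable hΘ hX₀
  · have h1 := (hasSum_forcedTerm (B := B) hb hHurwitz hT t i).mapL (L ψ)
    -- A scalar statement for which any Wiener curve will do; it is taken from one auxiliary channel
    -- because `μ` may be zero.
    have h2 : HasSum (fun k => ∑ l, ((sineFun T k t * expCoeff A T k i l : ℝ) : ℂ) • ξ l ψ)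
        (∑ l, ((NormedSpace.exp (t • A) i l - (1 : Matrix (Fin n) (Fin n) ℝ) i l : ℝ) : ℂ)
          • ξ l ψ) :=
      hasSum_sum fun l _ => (Complex.hasSum_ofReal.2 (hasSum_sineFun_mul_expCoeff
        (isWienerCurve_wienerTest (μ := 1) (0, 0)) hHurwitz hT ht i l)).smul_const _
    have h3 := h2.add h1
    -- Subtracting `ξ` replaces `e^{tA}` by `e^{tA} - 1`, which vanishes at `0` as its sine
    -- expansion requires.
    have h4 : X t i ψ - ξ i ψ =
        ∑ l, ((NormedSpace.exp (t • A) i l - (1 : Matrix (Fin n) (Fin n) ℝ) i l : ℝ) : ℂ)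
          • ξ l ψ + L ψ (z t i) := by
      rw [hsol t ht i ψ]
      simp only [Complex.ofReal_sub, sub_smul, Finset.sum_sub_distrib, Matrix.one_apply]
      simp [ite_smul]
      abel
    rw [h4]
    refine h3.congr_fun fun k => ?_
    rw [hterm]
    simp only [Pi.add_apply, Pi.neg_apply, LinearMap.add_apply, LinearMap.neg_apply,
      opMulVec_qklCoeff_apply, L, b, smul_add, smul_neg]
    rw [opMulVec]
    simp only [LinearMap.sum_apply, LinearMap.smul_apply, Finset.smul_sum, smul_smul,
      Complex.ofReal_mul, add_assoc]
    rw [← sub_eq_add_neg]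
    rfl
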